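/- Let $2<\alpha\le\infty$ and let $\Omega\subset\mathbb{C}$ be a conformal $\alpha$-regular domain, i.e. there is a conformal mapping $\psi$ (an injective holomorphic function) of the open unit disc $\mathbb{D}$ onto $\Omega$ with $\psi'\in L^{\alpha}(\mathbb{D})$. Let $\varphi:\mathbb{D}\to\Omega$ be any conformal mapping of $\mathbb{D}$ onto $\Omega$, and let $h=|\varphi'|^2$. Let $W^{1,2}(\Omega)$ be the space of real-valued, locally integrable, weakly differentiable functions $g$ on $\Omega$ with $\int_\Omega |g|^2\,du\,dv<\infty$ and $\int_\Omega|\nabla g|^2\,du\,dv<\infty$, and let $W^{1,2}(\mathbb{D},h,1)$ be the space of real-valued, locally integrable, weakly differentiable functions $f$ on $\mathbb{D}$ with $\|f\|_{L^2(\mathbb{D},h)}^2=\int_{\mathbb{D}}|f|^2h\,dx\,dy<\infty$ and $\int_{\mathbb{D}}|\nabla f|^2\,dx\,dy<\infty$. Then $0<|\Omega|<\infty$ and $0<\int_{\mathbb{D}}h\,dx\,dy<\infty$, and the mean values $$f_{\mathbb{D},h}=\frac{1}{\int_{\mathbb{D}}h\,dx\,dy}\int_{\mathbb{D}}f\,h\,dx\,dy,\qquad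 g_\Omega=\frac1{|\Omega|}\int_\Omega g\,du\,dv$$ are well defined (the integrals converge absolutely) for all $f\in W^{1,2}(\mathbb{D},h,1)$ and $g\in W^{1,2}(\Omega)$. Moreover, there is a finite constant $K^*\ge 0$ such that $$\|f-f_{\mathbb{D},h}\|_{L^2(\mathbb{D},h)}\le K^*\,\|\nabla f\|_{L^2(\mathbb{D})}\qquad\text{for all } f\in W^{1,2}(\mathbb{D},h,1).$$ The smallest constant $K^*\ge 0$ with this property is equal to the smallest constant $K\ge 0$ such that $$\|g-g_\Omega\|_{L^2(\Omega)}\le K\,\|\nabla g\|_{L^2(\Omega)}\qquad\text{for all } g\in W^{1,2}(\Omega);$$ in particular the latter exists and is finite. -/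

import Mathlib

open MeasureTheory
open scoped ENNReal NNReal ContDiff

noncomputable section

/-- The open unit disc `𝔻` of the complex plane. -/
def unitDisc : Set ℂ := Metric.ball 0 1

/-- `φ` restricts to a conformal mapping of `U` onto `Ω`, i.e. an injective holomorphic function
on `U` with image `Ω` (the values of `φ` outside `U` are irrelevant). -/
structure IsConformalOnto (φ : ℂ → ℂ) (U Ω : Set ℂ) : Prop where
  differentiableOn : DifferentiableOn ℂ φ U
  injOn : Set.InjOn φ U
  image_eq : φ '' U = Ω

/-- `Ω` is a conformal `α`-regular domain, `2 < α ≤ ∞`: some conformal mapping of the unit disc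
onto `Ω` has its derivative in `L^α(𝔻)`. -/
def IsConformalRegular (α : ℝ≥0∞) (Ω : Set ℂ) : Prop :=
  2 < α ∧ ∃ ψ : ℂ → ℂ, IsConformalOnto ψ unitDisc Ω ∧
    MemLp (deriv ψ) α (volume.restrict unitDisc)

/-- The locally integrable function `f : Ω → ℝ` is weakly differentiable on the open set `Ω` with
locally integrable weak gradient `G = f_x + i f_y` (a function which is unique up to null sets):
`∫_Ω f ∂_v η = - ∫_Ω (G · v) η` for all test functions `η ∈ C_c^∞(Ω)` and all directions `v`. -/
structure HasWeakGradient (Ω : Set ℂ) (f : ℂ → ℝ) (G : ℂ → ℂ) : Prop where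
  locallyIntegrableOn : LocallyIntegrableOn f Ω volume
  locallyIntegrableOn_grad : LocallyIntegrableOn G Ω volume
  integral_eq : ∀ η : ℂ → ℝ, ContDiff ℝ ∞ η → HasCompactSupport η → tsupport η ⊆ Ω →
    ∀ v : ℂ, ∫ z in Ω, f z * fderiv ℝ η z v = - ∫ z in Ω, inner ℝ (G z) v * η z

/-- The measure `h(z) dx dy` on `Ω`, for a non-negative weight `h`. -/
def weightMeasure (Ω : Set ℂ) (h : ℂ → ℝ) : Measure ℂ :=
  (volume.restrict Ω).withDensity fun z => ENNReal.ofReal (h z)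

/-- `f ∈ W^{1,2}(Ω)`, with weak gradient `G`. -/
structure MemSobolev (Ω : Set ℂ) (f : ℂ → ℝ) (G : ℂ → ℂ) : Prop where
  hasWeakGradient : HasWeakGradient Ω f G
  memLp : MemLp f 2 (volume.restrict Ω)
  memLp_grad : MemLp G 2 (volume.restrict Ω)

/-- `f ∈ W^{1,2}(Ω, h, 1)`, with weak gradient `G`: here `f` is square integrable with respect to
the weight `h`, and `G` with respect to Lebesgue measure. -/
structure MemWeightedSobolev (Ω : Set ℂ) (h : ℂ → ℝ) (f : ℂ → ℝ) (G : ℂ → ℂ) : Prop where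
  hasWeakGradient : HasWeakGradient Ω f G
  memLp : MemLp f 2 (weightMeasure Ω h)
  memLp_grad : MemLp G 2 (volume.restrict Ω)

/-- The mean value `g_Ω = |Ω|⁻¹ ∫_Ω g`. -/
def meanValue (Ω : Set ℂ) (g : ℂ → ℝ) : ℝ :=
  (volume.real Ω)⁻¹ * ∫ w in Ω, g w

/-- The weighted mean value `f_{Ω,h} = m_h(Ω)⁻¹ ∫_Ω f h`, where `m_h(Ω) = ∫_Ω h`. -/
def weightedMeanValue (Ω : Set ℂ) (h : ℂ → ℝ) (f : ℂ → ℝ) : ℝ :=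
  (∫ z in Ω, h z)⁻¹ * ∫ z in Ω, f z * h z

/-- The constants `K ≥ 0` with `‖g - g_Ω‖_{L²(Ω)} ≤ K ‖∇g‖_{L²(Ω)}` for all `g ∈ W^{1,2}(Ω)`. -/
def poincareConstants (Ω : Set ℂ) : Set ℝ≥0 :=
  {K | ∀ (g : ℂ → ℝ) (G : ℂ → ℂ), MemSobolev Ω g G →
    eLpNorm (fun w => g w - meanValue Ω g) 2 (volume.restrict Ω) ≤
      K * eLpNorm G 2 (volume.restrict Ω)}

/-- The constants `K ≥ 0` with `‖f - f_{Ω,h}‖_{L²(Ω,h)} ≤ K ‖∇f‖_{L²(Ω)}` for all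
`f ∈ W^{1,2}(Ω, h, 1)`. -/
def weightedPoincareConstants (Ω : Set ℂ) (h : ℂ → ℝ) : Set ℝ≥0 :=
  {K | ∀ (f : ℂ → ℝ) (G : ℂ → ℂ), MemWeightedSobolev Ω h f G →
    eLpNorm (fun z => f z - weightedMeanValue Ω h f) 2 (weightMeasure Ω h) ≤
      K * eLpNorm G 2 (volume.restrict Ω)}

/-- The conformal weight `h = |φ'|²`. -/
def conformalWeight (φ : ℂ → ℂ) (z : ℂ) : ℝ := ‖deriv φ z‖ ^ 2

end

section

open Filter Set Topology

/-! ### Critical points of injective holomorphic functions -/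

/-- An injective holomorphic function has no critical points. -/
theorem deriv_ne_zero_of_injOn {U : Set ℂ} {f : ℂ → ℂ} (hU : IsOpen U)
    (hf : DifferentiableOn ℂ f U) (hinj : InjOn f U) {z : ℂ} (hz : z ∈ U) : deriv f z ≠ 0 := by
  intro hd
  have hUz : U ∈ 𝓝 z := hU.mem_nhds hz
  have hfa : AnalyticAt ℂ f z := hf.analyticAt hUz
  have hga : AnalyticAt ℂ (fun w => f w - f z) z := hfa.sub analyticAt_const
  have hnc : ¬ ∀ᶠ w in 𝓝 z, f w - f z = 0 := by
    intro hev
    have h1 : ∀ᶠ w in 𝓝[≠] z, w ∈ U ∧ f w - f z = 0 :=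
      nhdsWithin_le_nhds (hev.and hUz |>.mono fun w hw => ⟨hw.2, hw.1⟩)
    obtain ⟨w, ⟨hwU, hw⟩, hne⟩ := (h1.and self_mem_nhdsWithin).exists
    exact hne (hinj hwU hz (sub_eq_zero.1 hw))
  -- If f' vanishes at z, then f - f z has a zero of order n ≥ 2 there. An n-th root ζ of it is a
  -- local coordinate, and the points with coordinates t and ξ t, for ξ a primitive n-th root of
  -- unity, have the same image.
  obtain ⟨n, g, hg, hg0, hgf⟩ := hga.exists_eventuallyEq_pow_smul_nonzero_iff.2 hnc
  have hn2 : 2 ≤ n := by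
    by_contra hlt
    interval_cases n
    · have := hgf.self_of_nhds
      simp at this
      exact hg0 this.symm
    · have h1 : HasDerivAt (fun w => (w - z) ^ 1 • g w)
          ((1 : ℂ) * g z + (z - z) * deriv g z) z := by
        simp only [pow_one]
        exact ((hasDerivAt_id z).sub_const z).mul hg.differentiableAt.hasDerivAt
      have h2 : HasDerivAt (fun w => f w - f z) (deriv f z) z :=
        hfa.differentiableAt.hasDerivAt.sub_const _
      have := (h1.congr_of_eventuallyEq hgf).unique h2
      rw [hd] at this
      simp at this
      exact hg0 this
  have hn0 : n ≠ 0 := by omega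
  obtain ⟨c, hc⟩ := IsAlgClosed.exists_pow_nat_eq (g z) (Nat.pos_of_ne_zero hn0)
  have hc0 : c ≠ 0 := by rintro rfl; rw [zero_pow hn0] at hc; exact hg0 hc.symm
  -- Dividing by `g z` moves the base of the power to 1, where the principal branch is analytic; `c`
  -- restores the lost factor.
  set k : ℂ → ℂ := fun w => (g w / g z) ^ ((n : ℂ)⁻¹) with hk
  have hka : AnalyticAt ℂ k z := by
    refine AnalyticAt.cpow (hg.div_const) analyticAt_const ?_
    simp [div_self hg0]
  have hkz : k z = 1 := by simp [hk, div_self hg0]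
  set ζ : ℂ → ℂ := fun w => (w - z) * (c * k w) with hζ
  have hζpow : ∀ᶠ w in 𝓝 z, ζ w ^ n = f w - f z := by
    filter_upwards [hgf] with w hw
    rw [hw, hζ]
    simp only [hk, mul_pow, Complex.cpow_nat_inv_pow _ hn0, hc, smul_eq_mul]
    field_simp
  have hζa : AnalyticAt ℂ ζ z := (analyticAt_id.sub analyticAt_const).mul
    (analyticAt_const.mul hka)
  have hζd : HasDerivAt ζ c z := by
    have := ((hasDerivAt_id z).sub_const z).mul
      ((hka.differentiableAt.hasDerivAt).const_mul c)
    exact this.congr_deriv (by simp [hkz])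
  have hζs : HasStrictDerivAt ζ c z := by
    have := hζa.hasStrictDerivAt
    rwa [hζd.deriv] at this
  have hmap : map ζ (𝓝 z) = 𝓝 0 := by
    have := hζs.map_nhds_eq hc0
    rwa [show ζ z = 0 by simp [hζ]] at this
  have hN : {w | w ∈ U ∧ ζ w ^ n = f w - f z} ∈ 𝓝 z := inter_mem hUz hζpow
  have hS : ζ '' {w | w ∈ U ∧ ζ w ^ n = f w - f z} ∈ 𝓝 (0 : ℂ) := by
    rw [← hmap]; exact image_mem_map hN
  have hξ := Complex.isPrimitiveRoot_exp n hn0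
  set ξ := Complex.exp (2 * Real.pi * Complex.I / n)
  have hcont : Tendsto (fun t : ℂ => ξ * t) (𝓝 0) (𝓝 0) := by
    simpa using (continuous_const_mul ξ).tendsto 0
  have hev := (nhdsWithin_le_nhds (inter_mem hS (hcont hS)) : _ ∈ 𝓝[≠] (0 : ℂ))
  obtain ⟨t, ⟨⟨w₁, ⟨h1U, h1⟩, h1t⟩, ⟨w₂, ⟨h2U, h2⟩, h2t⟩⟩, ht0⟩ :=
    (Filter.Eventually.and hev self_mem_nhdsWithin).exists
  have hww : w₁ = w₂ := by
    apply hinj h1U h2U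
    rw [← sub_left_inj (a := f z), ← h1, ← h2, h1t, h2t, mul_pow, hξ.pow_eq_one, one_mul]
  subst hww
  rw [h1t] at h2t
  have : ξ = 1 := by
    have h3 : (ξ - 1) * t = 0 := by
      have h4 : t = ξ * t := h2t
      linear_combination -h4
    rcases mul_eq_zero.1 h3 with h | h
    · exact sub_eq_zero.1 h
    · exact absurd h ht0
  exact hξ.ne_one (by omega) this

/-! ### Conformal maps and their inverses -/

namespace IsConformalOnto

variable {φ : ℂ → ℂ} {U V : Set ℂ}

theorem hasDerivAt (h : IsConformalOnto φ U V) (hU : IsOpen U) {z : ℂ} (hz : z ∈ U) :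
    HasDerivAt φ (deriv φ z) z :=
  (h.differentiableOn.differentiableAt (hU.mem_nhds hz)).hasDerivAt

theorem deriv_ne_zero (h : IsConformalOnto φ U V) (hU : IsOpen U) {z : ℂ} (hz : z ∈ U) :
    deriv φ z ≠ 0 :=
  deriv_ne_zero_of_injOn hU h.differentiableOn h.injOn hz

theorem analyticOnNhd (h : IsConformalOnto φ U V) (hU : IsOpen U) : AnalyticOnNhd ℂ φ U :=
  h.differentiableOn.analyticOnNhd hU

theorem map_nhds (h : IsConformalOnto φ U V) (hU : IsOpen U) {z : ℂ} (hz : z ∈ U) :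
    map φ (𝓝 z) = 𝓝 (φ z) :=
  (h.analyticOnNhd hU z hz).hasStrictDerivAt.map_nhds_eq (h.deriv_ne_zero hU hz)

theorem isOpen_image (h : IsConformalOnto φ U V) (hU : IsOpen U) : IsOpen V := by
  rw [← h.image_eq, isOpen_iff_mem_nhds]
  rintro _ ⟨z, hz, rfl⟩
  rw [← h.map_nhds hU hz]
  exact image_mem_map (hU.mem_nhds hz)

theorem mapsTo (h : IsConformalOnto φ U V) : MapsTo φ U V := by
  rw [← h.image_eq]; exact mapsTo_image φ U

theorem continuousOn_deriv (h : IsConformalOnto φ U V) (hU : IsOpen U) :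
    ContinuousOn (deriv φ) U :=
  (h.analyticOnNhd hU).deriv.continuousOn

theorem leftInvOn (h : IsConformalOnto φ U V) : LeftInvOn (Function.invFunOn φ U) φ U :=
  h.injOn.leftInvOn_invFunOn

theorem rightInvOn (h : IsConformalOnto φ U V) : RightInvOn (Function.invFunOn φ U) φ V := by
  rw [← h.image_eq]
  rintro _ ⟨z, hz, rfl⟩
  rw [h.leftInvOn hz]

theorem hasDerivAt_invFunOn (h : IsConformalOnto φ U V) (hU : IsOpen U) {z : ℂ} (hz : z ∈ U) :
    HasDerivAt (Function.invFunOn φ U) (deriv φ z)⁻¹ (φ z) := by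
  set ψ := Function.invFunOn φ U
  have hψ : ψ (φ z) = z := h.leftInvOn hz
  refine HasDerivAt.of_local_left_inverse (f := φ) ?_ ?_ (h.deriv_ne_zero hU hz) ?_
  · rw [ContinuousAt, ← h.map_nhds hU hz, tendsto_map'_iff, hψ]
    exact tendsto_id.congr' (by
      filter_upwards [hU.mem_nhds hz] with w hw using (h.leftInvOn hw).symm)
  · rw [hψ]; exact h.hasDerivAt hU hz
  · filter_upwards [(h.isOpen_image hU).mem_nhds (h.mapsTo hz)] with w hw using h.rightInvOn hw

theorem invFunOn (h : IsConformalOnto φ U V) (hU : IsOpen U) :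
    IsConformalOnto (Function.invFunOn φ U) V U where
  differentiableOn w hw := by
    rw [← h.image_eq] at hw
    obtain ⟨z, hz, rfl⟩ := hw
    exact (h.hasDerivAt_invFunOn hU hz).differentiableAt.differentiableWithinAt
  injOn := h.rightInvOn.injOn
  image_eq := by
    rw [← h.image_eq]
    exact h.leftInvOn.image_image

theorem deriv_invFunOn (h : IsConformalOnto φ U V) (hU : IsOpen U) {z : ℂ} (hz : z ∈ U) :
    deriv (Function.invFunOn φ U) (φ z) = (deriv φ z)⁻¹ :=
  (h.hasDerivAt_invFunOn hU hz).deriv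

end IsConformalOnto

/-! ### Change of variables: measures, norms and integrability -/

theorem det_smul_one_complex (c : ℂ) : (c • (1 : ℂ →L[ℝ] ℂ)).det = ‖c‖ ^ 2 := by
  have h : ((c • (1 : ℂ →L[ℝ] ℂ) : ℂ →L[ℝ] ℂ) : ℂ →ₗ[ℝ] ℂ) = Algebra.lmul ℝ ℂ c := by
    ext; all_goals simp
  rw [ContinuousLinearMap.det, h, ← Algebra.norm_apply, Algebra.norm_complex_apply,
    Complex.normSq_eq_norm_sq]

/-- A locally integrable function times a continuous function compactly supported in the domain
is integrable. -/
theorem MeasureTheory.LocallyIntegrableOn.integrableOn_smul_of_tsupport_subset {E : Type*}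
    [NormedAddCommGroup E] [NormedSpace ℝ E] {V : Set ℂ} {g : ℂ → E}
    (hg : LocallyIntegrableOn g V volume) {θ : ℂ → ℝ} (hθ : Continuous θ)
    (hc : HasCompactSupport θ) (hs : tsupport θ ⊆ V) :
    IntegrableOn (fun w => θ w • g w) V := by
  have h1 : IntegrableOn (fun w => θ w • g w) (tsupport θ) :=
    (hg.integrableOn_compact_subset hs hc).continuousOn_smul hθ.continuousOn hc
  refine (integrableOn_iff_integrable_of_support_subset (s := tsupport θ) ?_ |>.1 h1).integrableOn
  intro w hw
  apply subset_tsupport θ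
  intro h0
  exact hw (by simp [h0])

namespace IsConformalOnto

variable {φ : ℂ → ℂ} {U V : Set ℂ}

theorem abs_det (z : ℂ) :
    |(deriv φ z • (1 : ℂ →L[ℝ] ℂ)).det| = conformalWeight φ z := by
  rw [det_smul_one_complex, abs_of_nonneg (by positivity), conformalWeight]

theorem hasFDerivWithinAt (h : IsConformalOnto φ U V) (hU : IsOpen U) {S : Set ℂ} (hS : S ⊆ U) :
    ∀ z ∈ S, HasFDerivWithinAt φ (deriv φ z • (1 : ℂ →L[ℝ] ℂ)) S z := fun _ hz =>
  (h.hasDerivAt hU (hS hz)).complexToReal_fderiv.hasFDerivWithinAt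

theorem lintegral_eq (h : IsConformalOnto φ U V) (hU : IsOpen U) (g : ℂ → ℝ≥0∞) :
    ∫⁻ w in V, g w = ∫⁻ z in U, ENNReal.ofReal (conformalWeight φ z) * g (φ z) := by
  rw [← h.image_eq, lintegral_image_eq_lintegral_abs_det_fderiv_mul volume hU.measurableSet
    (h.hasFDerivWithinAt hU subset_rfl) h.injOn]
  simp only [abs_det]

theorem integral_eq {E : Type*} [NormedAddCommGroup E] [NormedSpace ℝ E]
    (h : IsConformalOnto φ U V) (hU : IsOpen U) (g : ℂ → E) :
    ∫ w in V, g w = ∫ z in U, conformalWeight φ z • g (φ z) := by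
  rw [← h.image_eq, integral_image_eq_integral_abs_det_fderiv_smul volume hU.measurableSet
    (h.hasFDerivWithinAt hU subset_rfl) h.injOn]
  simp only [abs_det]

theorem integrableOn_image_iff {E : Type*} [NormedAddCommGroup E] [NormedSpace ℝ E]
    (h : IsConformalOnto φ U V) (hU : IsOpen U) {S : Set ℂ} (hS : S ⊆ U) (hSm : MeasurableSet S)
    (g : ℂ → E) :
    IntegrableOn g (φ '' S) ↔ IntegrableOn (fun z => conformalWeight φ z • g (φ z)) S := by
  rw [integrableOn_image_iff_integrableOn_abs_det_fderiv_smul volume hSm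
    (h.hasFDerivWithinAt hU hS) (h.injOn.mono hS)]
  simp only [abs_det]

theorem conformalWeight_pos (h : IsConformalOnto φ U V) (hU : IsOpen U) {z : ℂ} (hz : z ∈ U) :
    0 < conformalWeight φ z :=
  pow_pos (norm_pos_iff.2 (h.deriv_ne_zero hU hz)) 2

theorem continuousOn_conformalWeight (h : IsConformalOnto φ U V) (hU : IsOpen U) :
    ContinuousOn (conformalWeight φ) U :=
  (h.continuousOn_deriv hU).norm.pow 2

theorem aemeasurable (h : IsConformalOnto φ U V) (hU : IsOpen U) :
    AEMeasurable φ (volume.restrict U) :=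
  h.differentiableOn.continuousOn.aemeasurable hU.measurableSet

theorem weightMeasure_absolutelyContinuous (φ : ℂ → ℂ) (U : Set ℂ) :
    weightMeasure U (conformalWeight φ) ≪ volume.restrict U :=
  withDensity_absolutelyContinuous _ _

theorem map_weightMeasure (h : IsConformalOnto φ U V) (hU : IsOpen U) :
    Measure.map φ (weightMeasure U (conformalWeight φ)) = volume.restrict V := by
  rw [← h.image_eq, weightMeasure, ← map_withDensity_abs_det_fderiv_eq_addHaar volume
    hU.measurableSet.nullMeasurableSet (h.hasFDerivWithinAt hU subset_rfl) h.injOn]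
  simp only [abs_det]

/-- The weight vanishes nowhere on U, so both measures have the same null sets; this brings
measurability on V back to Lebesgue measure on U. -/
theorem restrict_absolutelyContinuous_weightMeasure (h : IsConformalOnto φ U V) (hU : IsOpen U) :
    volume.restrict U ≪ weightMeasure U (conformalWeight φ) := by
  refine withDensity_absolutelyContinuous' ?_ ?_
  · exact ((h.continuousOn_conformalWeight hU).aemeasurable hU.measurableSet).ennreal_ofReal
  · filter_upwards [ae_restrict_mem hU.measurableSet] with z hz
    simpa using h.conformalWeight_pos hU hz

theorem map_invFunOn (h : IsConformalOnto φ U V) (hU : IsOpen U) :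
    Measure.map (Function.invFunOn φ U) (volume.restrict V) =
      weightMeasure U (conformalWeight φ) := by
  have hφm := (h.aemeasurable hU).mono_ac (weightMeasure_absolutelyContinuous φ U)
  have hψm := (h.invFunOn hU).aemeasurable (h.isOpen_image hU)
  rw [← h.map_weightMeasure hU] at hψm ⊢
  rw [AEMeasurable.map_map_of_aemeasurable hψm hφm]
  conv_rhs => rw [← Measure.map_id (μ := weightMeasure U (conformalWeight φ))]
  refine Measure.map_congr ((weightMeasure_absolutelyContinuous φ U).ae_le ?_)
  filter_upwards [ae_restrict_mem hU.measurableSet] with z hz using h.leftInvOn hz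

theorem aestronglyMeasurable_comp {E : Type*} [TopologicalSpace E]
    (h : IsConformalOnto φ U V) (hU : IsOpen U) {g : ℂ → E}
    (hg : AEStronglyMeasurable g (volume.restrict V)) :
    AEStronglyMeasurable (g ∘ φ) (volume.restrict U) := by
  rw [← h.map_weightMeasure hU] at hg
  exact (hg.comp_aemeasurable ((h.aemeasurable hU).mono_ac
    (weightMeasure_absolutelyContinuous φ U))).mono_ac
      (h.restrict_absolutelyContinuous_weightMeasure hU)

theorem eLpNorm_comp {E : Type*} [NormedAddCommGroup E] (h : IsConformalOnto φ U V)
    (hU : IsOpen U) {g : ℂ → E} (hg : AEStronglyMeasurable g (volume.restrict V)) (p : ℝ≥0∞) :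
    eLpNorm (g ∘ φ) p (weightMeasure U (conformalWeight φ)) =
      eLpNorm g p (volume.restrict V) := by
  rw [← h.map_weightMeasure hU] at hg ⊢
  exact (eLpNorm_map_measure hg ((h.aemeasurable hU).mono_ac
    (weightMeasure_absolutelyContinuous φ U))).symm

/-- The gradient of `g ∘ φ` in terms of the gradient `G` of `g`. -/
noncomputable def _root_.pullbackGradient (φ : ℂ → ℂ) (G : ℂ → ℂ) (z : ℂ) : ℂ :=
  (starRingEnd ℂ) (deriv φ z) * G (φ z)

/-- The factor |φ'|² in the squared gradient is exactly the Jacobian: in dimension two the Dirichlet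
integral is conformally invariant. -/
theorem eLpNorm_pullbackGradient (h : IsConformalOnto φ U V) (hU : IsOpen U) (G : ℂ → ℂ) :
    eLpNorm (pullbackGradient φ G) 2 (volume.restrict U) = eLpNorm G 2 (volume.restrict V) := by
  rw [eLpNorm_eq_lintegral_rpow_enorm_toReal (by simp) (by simp),
    eLpNorm_eq_lintegral_rpow_enorm_toReal (by simp) (by simp), h.lintegral_eq hU]
  congr 2
  ext z
  simp only [pullbackGradient, conformalWeight, enorm_mul, ENNReal.toReal_ofNat]
  rw [ENNReal.mul_rpow_of_nonneg _ _ (by norm_num), ENNReal.ofReal_pow (norm_nonneg _),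
    ofReal_norm, RCLike.enorm_conj]
  norm_cast

theorem aestronglyMeasurable_pullbackGradient (h : IsConformalOnto φ U V) (hU : IsOpen U)
    {G : ℂ → ℂ} (hG : AEStronglyMeasurable G (volume.restrict V)) :
    AEStronglyMeasurable (pullbackGradient φ G) (volume.restrict U) :=
  ((Complex.continuous_conj.comp_continuousOn (h.continuousOn_deriv hU)).aestronglyMeasurable
    hU.measurableSet).mul (h.aestronglyMeasurable_comp hU hG)

theorem locallyIntegrableOn_comp {E : Type*} [NormedAddCommGroup E] [NormedSpace ℝ E]
    (h : IsConformalOnto φ U V) (hU : IsOpen U) {g : ℂ → E}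
    (hg : LocallyIntegrableOn g V volume) : LocallyIntegrableOn (g ∘ φ) U volume := by
  rw [locallyIntegrableOn_iff hU.isLocallyClosed]
  intro k hk hkc
  have h1 : IntegrableOn g (φ '' k) :=
    hg.integrableOn_compact_subset (h.mapsTo.mono_left hk).image_subset
      (hkc.image_of_continuousOn (h.differentiableOn.continuousOn.mono hk))
  rw [h.integrableOn_image_iff hU hk hkc.measurableSet] at h1
  have h2 := h1.continuousOn_smul (f := fun z => (conformalWeight φ z)⁻¹)
    (((h.continuousOn_conformalWeight hU).mono hk).inv₀
      fun z hz => (h.conformalWeight_pos hU (hk hz)).ne') hkc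
  refine h2.congr_fun (fun z hz => ?_) hkc.measurableSet
  simp [smul_smul, inv_mul_cancel₀ (h.conformalWeight_pos hU (hk hz)).ne']

theorem locallyIntegrableOn_pullbackGradient (h : IsConformalOnto φ U V) (hU : IsOpen U)
    {G : ℂ → ℂ} (hG : LocallyIntegrableOn G V volume) :
    LocallyIntegrableOn (pullbackGradient φ G) U volume :=
  (h.locallyIntegrableOn_comp hU hG).continuousOn_mul
    (Complex.continuous_conj.comp_continuousOn (h.continuousOn_deriv hU)) hU.isLocallyClosed

end IsConformalOnto

/-! ### Transport of test functions and weak gradients -/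

/-- A function smooth on an open set `V` and vanishing outside a compact subset of `V` is
smooth. -/
theorem contDiff_of_eqOn_zero {V K : Set ℂ} (hV : IsOpen V) (hK : IsCompact K) (hKV : K ⊆ V)
    {θ : ℂ → ℝ} (hθ : ContDiffOn ℝ ∞ θ V) (h0 : ∀ w ∉ K, θ w = 0) : ContDiff ℝ ∞ θ := by
  rw [contDiff_iff_contDiffAt]
  intro w
  by_cases hw : w ∈ V
  · exact hθ.contDiffAt (hV.mem_nhds hw)
  · have : θ =ᶠ[𝓝 w] fun _ => 0 := by
      filter_upwards [hK.isClosed.isOpen_compl.mem_nhds (fun h => hw (hKV h))] with x hx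
        using h0 x hx
    exact contDiffAt_const.congr_of_eventuallyEq this

theorem tsupport_subset_of_eqOn_zero {K : Set ℂ} (hK : IsCompact K)
    {θ : ℂ → ℝ} (h0 : ∀ w ∉ K, θ w = 0) : tsupport θ ⊆ K :=
  closure_minimal (fun w hw => by_contra fun h => hw (h0 w h)) hK.isClosed

namespace IsConformalOnto

variable {φ : ℂ → ℂ} {U V : Set ℂ}

theorem contDiffOn (h : IsConformalOnto φ U V) (hU : IsOpen U) : ContDiffOn ℝ ∞ φ U :=
  fun z hz => ((h.analyticOnNhd hU z hz).contDiffAt.restrict_scalars ℝ).contDiffWithinAt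

theorem contDiffOn_deriv (h : IsConformalOnto φ U V) (hU : IsOpen U) :
    ContDiffOn ℝ ∞ (deriv φ) U :=
  fun z hz => ((h.analyticOnNhd hU z hz).deriv.contDiffAt.restrict_scalars ℝ).contDiffWithinAt

/-- The image of the test function `η` times the component along `e` of the (divergence free)
vector field `conj φ' · v`. -/
noncomputable def _root_.pullbackTest (φ : ℂ → ℂ) (U : Set ℂ) (η : ℂ → ℝ) (v e : ℂ) : ℂ → ℝ :=
  U.indicator fun w => η (φ w) * inner ℝ e ((starRingEnd ℂ) (deriv φ w) * v)

theorem pullbackTest_eq_zero (h : IsConformalOnto φ U V) {η : ℂ → ℝ} (v e : ℂ) :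
    ∀ w ∉ Function.invFunOn φ U '' tsupport η, pullbackTest φ U η v e w = 0 := by
  intro w hw
  by_cases hwU : w ∈ U
  · have : η (φ w) = 0 := by
      by_contra hne
      exact hw ⟨φ w, subset_tsupport η hne, h.leftInvOn hwU⟩
    simp [pullbackTest, hwU, this]
  · simp [pullbackTest, hwU]

theorem isCompact_invFunOn_image (h : IsConformalOnto φ U V) (hU : IsOpen U) {K : Set ℂ}
    (hK : IsCompact K) (hKV : K ⊆ V) :
    IsCompact (Function.invFunOn φ U '' K) ∧ Function.invFunOn φ U '' K ⊆ U :=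
  ⟨hK.image_of_continuousOn ((h.invFunOn hU).differentiableOn.continuousOn.mono hKV),
    ((h.invFunOn hU).mapsTo.mono_left hKV).image_subset⟩

theorem contDiff_pullbackTest (h : IsConformalOnto φ U V) (hU : IsOpen U) {η : ℂ → ℝ}
    (hη : ContDiff ℝ ∞ η) (hc : HasCompactSupport η) (hs : tsupport η ⊆ V) (v e : ℂ) :
    ContDiff ℝ ∞ (pullbackTest φ U η v e) := by
  obtain ⟨hK, hKU⟩ := h.isCompact_invFunOn_image hU hc hs
  refine contDiff_of_eqOn_zero hU hK hKU ?_ (h.pullbackTest_eq_zero v e)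
  have h1 : ContDiffOn ℝ ∞ (fun w => η (φ w)) U := hη.comp_contDiffOn (h.contDiffOn hU)
  have h2 : ContDiffOn ℝ ∞ (fun w => (starRingEnd ℂ) (deriv φ w)) U :=
    Complex.conjCLE.contDiff.comp_contDiffOn (h.contDiffOn_deriv hU)
  have h3 : ContDiffOn ℝ ∞ (fun w => η (φ w) * inner ℝ e ((starRingEnd ℂ) (deriv φ w) * v)) U :=
    h1.mul (contDiffOn_const.inner ℝ (h2.mul contDiffOn_const))
  exact h3.congr fun w hw => by simp [pullbackTest, hw]

/-- The vector field `conj φ' · v` is divergence free. -/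
theorem fderiv_pullbackTest_add (h : IsConformalOnto φ U V) (hU : IsOpen U) {η : ℂ → ℝ}
    (hη : ContDiff ℝ ∞ η) (v : ℂ) {w : ℂ} (hw : w ∈ U) :
    fderiv ℝ (pullbackTest φ U η v 1) w 1 + fderiv ℝ (pullbackTest φ U η v Complex.I) w Complex.I
      = conformalWeight φ w * fderiv ℝ η (φ w) v := by
  have hφ := (h.hasDerivAt hU hw).complexToReal_fderiv
  have hdφ := ((h.analyticOnNhd hU).deriv w hw).differentiableAt.hasDerivAt.complexToReal_fderiv
  have hη' := (hη.differentiable (by simp) (φ w)).hasFDerivAt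
  have key : ∀ e : ℂ, HasFDerivAt (pullbackTest φ U η v e) _ w := fun e => by
    refine ((hη'.comp w hφ).mul (((hasFDerivAt_const e w).inner ℝ
      ((Complex.conjCLE.hasFDerivAt.comp w hdφ).mul_const v)))).congr_of_eventuallyEq ?_
    filter_upwards [hU.mem_nhds hw] with z hz
    simp [pullbackTest, hz]
  rw [(key 1).fderiv, (key Complex.I).fderiv]
  set A := fderiv ℝ η (φ w)
  have hA : ∀ z : ℂ, A z = z.re * A 1 + z.im * A Complex.I := fun z => by
    conv_lhs => rw [show z = z.re • (1 : ℂ) + z.im • Complex.I by simp]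
    rw [map_add, map_smul, map_smul]; simp
  have hcw : conformalWeight φ w = (deriv φ w).re ^ 2 + (deriv φ w).im ^ 2 := by
    rw [conformalWeight, ← Complex.normSq_eq_norm_sq, Complex.normSq_apply]; ring
  -- The terms with the second derivative of φ cancel because conj φ' · v is antiholomorphic; the
  -- rest is an identity in real coordinates.
  simp [hcw, Complex.inner]
  rw [hA (deriv φ w), hA (deriv φ w * Complex.I), hA v]
  simp
  ring

end IsConformalOnto

namespace IsConformalOnto

variable {φ : ℂ → ℂ} {U V : Set ℂ}

/-- The chain rule is obtained by moving the test function instead of approximating g. With ψ = φ⁻¹,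
the function |ψ'|² (∂_v η)∘ψ is the divergence of (η∘ψ) conj ψ' · v, whose two components are test
functions on V. -/
theorem hasWeakGradient_comp (h : IsConformalOnto φ U V) (hU : IsOpen U) {g : ℂ → ℝ} {G : ℂ → ℂ}
    (hg : HasWeakGradient V g G) : HasWeakGradient U (g ∘ φ) (pullbackGradient φ G) where
  locallyIntegrableOn := h.locallyIntegrableOn_comp hU hg.locallyIntegrableOn
  locallyIntegrableOn_grad :=
    h.locallyIntegrableOn_pullbackGradient hU hg.locallyIntegrableOn_grad
  integral_eq η hη hc hs v := by
    have hV := h.isOpen_image hU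
    have hψ := h.invFunOn hU
    set ψ := Function.invFunOn φ U
    have hθ := fun e => hψ.contDiff_pullbackTest hV hη hc hs v e
    obtain ⟨hK, hKV⟩ := hψ.isCompact_invFunOn_image hV hc hs
    have hθs := fun e => tsupport_subset_of_eqOn_zero hK (hψ.pullbackTest_eq_zero (η := η) v e)
    have hθc : ∀ e, HasCompactSupport (pullbackTest ψ V η v e) := fun e =>
      hK.of_isClosed_subset (isClosed_tsupport _) (hθs e)
    have hint := fun e => hg.integral_eq _ (hθ e) (hθc e) ((hθs e).trans hKV) e
    have hi1 : ∀ e, IntegrableOn (fun w => g w * fderiv ℝ (pullbackTest ψ V η v e) w e) V := by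
      intro e
      have h1 : Continuous fun w => fderiv ℝ (pullbackTest ψ V η v e) w e :=
        ((hθ e).continuous_fderiv (by simp)).clm_apply continuous_const
      have h2 : tsupport (fun w => fderiv ℝ (pullbackTest ψ V η v e) w e) ⊆
          tsupport (pullbackTest ψ V η v e) := tsupport_fderiv_apply_subset ℝ e
      have := hg.locallyIntegrableOn.integrableOn_smul_of_tsupport_subset h1
        ((hθc e).of_isClosed_subset (isClosed_tsupport _) h2) (h2.trans ((hθs e).trans hKV))
      simpa only [smul_eq_mul, mul_comm] using this
    have hi2 : ∀ e, IntegrableOn (fun w => inner ℝ (G w) e * pullbackTest ψ V η v e w) V := by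
      intro e
      have := (hg.locallyIntegrableOn_grad.integrableOn_smul_of_tsupport_subset
        (hθ e).continuous (hθc e) ((hθs e).trans hKV)).inner_const e (𝕜 := ℝ)
      simpa only [real_inner_smul_left, mul_comm, IntegrableOn] using this
    rw [hψ.integral_eq hV, hψ.integral_eq hV]
    have e1 : ∫ w in V, conformalWeight ψ w • ((g ∘ φ) (ψ w) * fderiv ℝ η (ψ w) v) =
        ∫ w in V, (g w * fderiv ℝ (pullbackTest ψ V η v 1) w 1 +
          g w * fderiv ℝ (pullbackTest ψ V η v Complex.I) w Complex.I) := by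
      refine setIntegral_congr_fun hV.measurableSet fun w hw => ?_
      have hr : φ (ψ w) = w := h.rightInvOn hw
      simp only [← mul_add, hψ.fderiv_pullbackTest_add hV hη v hw, Function.comp_apply, hr,
        smul_eq_mul]
      ring
    -- Since φ'∘ψ = 1/ψ', one has ⟨conj(1/ψ') G, v⟩ |ψ'|² = ⟨G, conj ψ' · v⟩.
    have e2 : ∫ w in V, conformalWeight ψ w • (inner ℝ (pullbackGradient φ G (ψ w)) v * η (ψ w)) =
        ∫ w in V, (inner ℝ (G w) 1 * pullbackTest ψ V η v 1 w +
          inner ℝ (G w) Complex.I * pullbackTest ψ V η v Complex.I w) := by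
      refine setIntegral_congr_fun hV.measurableSet fun w hw => ?_
      have hr : φ (ψ w) = w := h.rightInvOn hw
      have hd : deriv φ (ψ w) = (deriv ψ w)⁻¹ := by
        have := h.deriv_invFunOn hU (hψ.mapsTo hw)
        rw [hr] at this
        rw [this, inv_inv]
      have hne : Complex.normSq (deriv ψ w) ≠ 0 := by
        simpa using hψ.deriv_ne_zero hV hw
      simp only [pullbackGradient, pullbackTest, hw, indicator_of_mem, hr, hd, smul_eq_mul,
        conformalWeight, ← Complex.normSq_eq_norm_sq]
      simp [Complex.inner]
      field_simp
      ring
    rw [e1, e2, integral_add (hi1 1) (hi1 Complex.I), integral_add (hi2 1) (hi2 Complex.I),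
      hint 1, hint Complex.I]
    ring

/-! ### Conformal invariance of the Poincaré constants -/

theorem isFiniteMeasure_weightMeasure (h : IsConformalOnto φ U V) (hU : IsOpen U)
    (hfin : volume V ≠ ⊤) :
    IsFiniteMeasure (weightMeasure U (conformalWeight φ)) := by
  refine ⟨?_⟩
  rw [← h.map_invFunOn hU, Measure.map_apply_of_aemeasurable
    ((h.invFunOn hU).aemeasurable (h.isOpen_image hU)) MeasurableSet.univ]
  simpa using hfin.lt_top

theorem memWeightedSobolev_comp (h : IsConformalOnto φ U V) (hU : IsOpen U) {g : ℂ → ℝ}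
    {G : ℂ → ℂ} (hg : MemSobolev V g G) :
    MemWeightedSobolev U (conformalWeight φ) (g ∘ φ) (pullbackGradient φ G) where
  hasWeakGradient := h.hasWeakGradient_comp hU hg.hasWeakGradient
  memLp := ⟨(h.aestronglyMeasurable_comp hU hg.memLp.1).mono_ac
      (weightMeasure_absolutelyContinuous φ U), by
    rw [h.eLpNorm_comp hU hg.memLp.1]; exact hg.memLp.2⟩
  memLp_grad := ⟨h.aestronglyMeasurable_pullbackGradient hU hg.memLp_grad.1, by
    rw [h.eLpNorm_pullbackGradient hU]; exact hg.memLp_grad.2⟩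

theorem memSobolev_comp_invFunOn (h : IsConformalOnto φ U V) (hU : IsOpen U) {f : ℂ → ℝ}
    {F : ℂ → ℂ} (hf : MemWeightedSobolev U (conformalWeight φ) f F) :
    MemSobolev V (f ∘ Function.invFunOn φ U) (pullbackGradient (Function.invFunOn φ U) F) where
  hasWeakGradient := (h.invFunOn hU).hasWeakGradient_comp (h.isOpen_image hU) hf.hasWeakGradient
  memLp := by
    have := hf.memLp
    have hψ := (h.invFunOn hU).aemeasurable (h.isOpen_image hU)
    rw [← h.map_invFunOn hU] at this
    exact (memLp_map_measure_iff this.1 hψ).1 this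
  memLp_grad := ⟨(h.invFunOn hU).aestronglyMeasurable_pullbackGradient (h.isOpen_image hU)
      hf.memLp_grad.1, by
    rw [(h.invFunOn hU).eLpNorm_pullbackGradient (h.isOpen_image hU)]; exact hf.memLp_grad.2⟩

theorem weightedMeanValue_comp (h : IsConformalOnto φ U V) (hU : IsOpen U) (g : ℂ → ℝ) :
    weightedMeanValue U (conformalWeight φ) (g ∘ φ) = meanValue V g := by
  have h1 : volume.real V = ∫ z in U, conformalWeight φ z := by
    have := h.integral_eq hU (fun _ => (1 : ℝ))
    simpa using this
  rw [weightedMeanValue, meanValue, h.integral_eq hU, h1]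
  simp [mul_comm]

theorem weightedMeanValue_comp_invFunOn (h : IsConformalOnto φ U V) (hU : IsOpen U) (f : ℂ → ℝ) :
    meanValue V (f ∘ Function.invFunOn φ U) = weightedMeanValue U (conformalWeight φ) f := by
  rw [← h.weightedMeanValue_comp hU, weightedMeanValue, weightedMeanValue]
  congr 1
  refine setIntegral_congr_fun hU.measurableSet fun z hz => ?_
  simp [h.leftInvOn hz]

/-- Conformal invariance of the Poincaré inequality. -/
theorem weightedPoincareConstants_eq (h : IsConformalOnto φ U V) (hU : IsOpen U) :
    weightedPoincareConstants U (conformalWeight φ) = poincareConstants V := by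
  ext K
  constructor
  · intro hK g G hg
    have := hK _ _ (h.memWeightedSobolev_comp hU hg)
    rw [h.eLpNorm_pullbackGradient hU, h.weightedMeanValue_comp hU] at this
    refine le_trans (le_of_eq ?_) this
    exact (h.eLpNorm_comp hU (hg.memLp.1.sub aestronglyMeasurable_const) 2).symm
  · intro hK f F hf
    have := hK _ _ (h.memSobolev_comp_invFunOn hU hf)
    rw [(h.invFunOn hU).eLpNorm_pullbackGradient (h.isOpen_image hU),
      h.weightedMeanValue_comp_invFunOn hU] at this
    refine le_trans (le_of_eq ?_) this
    have hm := hf.memLp.1.sub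
      (aestronglyMeasurable_const (b := weightedMeanValue U (conformalWeight φ) f))
    rw [← h.map_invFunOn hU] at hm ⊢
    exact eLpNorm_map_measure hm ((h.invFunOn hU).aemeasurable (h.isOpen_image hU))

end IsConformalOnto

/-- The set of constants in the Poincaré inequality contains its infimum. -/
theorem isLeast_sInf_poincareConstants {Ω : Set ℂ} (hne : (poincareConstants Ω).Nonempty) :
    IsLeast (poincareConstants Ω) (sInf (poincareConstants Ω)) := by
  have hcl : IsClosed (poincareConstants Ω) := by
    simp only [poincareConstants, ofPred_forall]
    refine isClosed_iInter fun g => isClosed_iInter fun G => isClosed_iInter fun hg => ?_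
    refine isClosed_le continuous_const ?_
    -- Finiteness of the norm of G is what makes K ↦ K ‖G‖ continuous, also at K = 0.
    exact (ENNReal.continuous_mul_const hg.memLp_grad.2.ne).comp ENNReal.continuous_coe
  exact ⟨hcl.csInf_mem hne (OrderBot.bddBelow _), fun K hK => csInf_le (OrderBot.bddBelow _) hK⟩

/-! ### Differences of smooth functions and Riesz kernels -/

/-- The Cauchy–Schwarz inequality for the lower Lebesgue integral. -/
theorem lintegral_mul_sq_le {X : Type*} [MeasurableSpace X] {μ : Measure X} {a b : X → ℝ≥0∞}
    (ha : AEMeasurable a μ) (hb : AEMeasurable b μ) :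
    (∫⁻ x, a x * b x ∂μ) ^ 2 ≤ (∫⁻ x, a x ^ 2 ∂μ) * ∫⁻ x, b x ^ 2 ∂μ := by
  have h := ENNReal.lintegral_mul_le_Lp_mul_Lq μ Real.HolderConjugate.two_two ha hb
  simp only [Pi.mul_apply, ENNReal.rpow_two] at h
  calc _ ≤ _ := pow_le_pow_left₀ zero_le h 2
    _ = _ := by
      rw [mul_pow, ← ENNReal.rpow_two, ← ENNReal.rpow_two, ← ENNReal.rpow_mul, ← ENNReal.rpow_mul]
      norm_num

/-- The integral `∫₀¹ t ^ (δ - 1) dt`. -/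
noncomputable def rpowIntegral (δ : ℝ) : ℝ≥0∞ := ∫⁻ t in Ioc (0 : ℝ) 1, ENNReal.ofReal (t ^ (δ - 1))

theorem rpowIntegral_lt_top {δ : ℝ} (hδ : 0 < δ) : rpowIntegral δ < ⊤ := by
  have h := (intervalIntegral.intervalIntegrable_rpow' (a := 0) (b := 1) (r := δ - 1)
    (by linarith))
  rw [intervalIntegrable_iff_integrableOn_Ioc_of_le zero_le_one] at h
  exact h.lintegral_lt_top

theorem enorm_sub_le_lintegral_fderiv {f : ℂ → ℝ} (hf : ContDiff ℝ 1 f) (x y : ℂ) :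
    ‖f y - f x‖ₑ ≤ ∫⁻ t in Ioc (0 : ℝ) 1, ‖fderiv ℝ f (x + t • (y - x))‖ₑ * ‖y - x‖ₑ := by
  have hline : ∀ t : ℝ, HasDerivAt (fun t : ℝ => x + t • (y - x)) (y - x) t := fun t => by
    simpa using ((hasDerivAt_id t).smul_const (y - x)).const_add x
  have hd : ∀ t : ℝ, HasDerivAt (fun t : ℝ => f (x + t • (y - x)))
      (fderiv ℝ f (x + t • (y - x)) (y - x)) t := fun t =>
    ((hf.differentiable (by simp)) _).hasFDerivAt.comp_hasDerivAt t (hline t)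
  have hcont : Continuous fun t : ℝ => fderiv ℝ f (x + t • (y - x)) (y - x) :=
    ((hf.continuous_fderiv (by simp)).comp (by fun_prop)).clm_apply continuous_const
  have h := intervalIntegral.integral_eq_sub_of_hasDerivAt (a := 0) (b := 1)
    (fun t _ => hd t) (hcont.intervalIntegrable 0 1)
  simp only [one_smul, zero_smul, add_zero, add_sub_cancel] at h
  rw [← h, intervalIntegral.integral_of_le zero_le_one]
  refine (enorm_integral_le_lintegral_enorm _).trans (lintegral_mono fun t => ?_)
  exact ContinuousLinearMap.le_opENorm _ _

/-- Cauchy–Schwarz on the segment after inserting 1 = t^((δ-1)/2) t^((1-δ)/2). The weight t^(1-δ)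
left inside offsets part of the Jacobian of the dilation used later. -/
theorem enorm_sub_sq_le_lintegral_fderiv {f : ℂ → ℝ} (hf : ContDiff ℝ 1 f) (δ : ℝ) (x y : ℂ) :
    ‖f y - f x‖ₑ ^ 2 ≤ rpowIntegral δ * ∫⁻ t in Ioc (0 : ℝ) 1,
      ENNReal.ofReal (t ^ (1 - δ)) * (‖fderiv ℝ f (x + t • (y - x))‖ₑ ^ 2 * ‖y - x‖ₑ ^ 2) := by
  have hm : Measurable fun t : ℝ => ‖fderiv ℝ f (x + t • (y - x))‖ₑ :=
    ((hf.continuous_fderiv (by simp)).comp (by fun_prop : Continuous fun t : ℝ =>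
      x + t • (y - x))).enorm.measurable
  have hcs := lintegral_mul_sq_le (μ := volume.restrict (Ioc (0 : ℝ) 1))
    (a := fun t => ENNReal.ofReal (t ^ ((δ - 1) / 2)))
    (b := fun t => ENNReal.ofReal (t ^ ((1 - δ) / 2)) *
      (‖fderiv ℝ f (x + t • (y - x))‖ₑ * ‖y - x‖ₑ))
    (by fun_prop) (by fun_prop)
  refine (pow_le_pow_left₀ zero_le (enorm_sub_le_lintegral_fderiv hf x y) 2).trans ?_
  have hsq : ∀ s : ℝ, ∀ t ∈ Ioc (0 : ℝ) 1, ENNReal.ofReal (t ^ (s / 2)) ^ 2 =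
      ENNReal.ofReal (t ^ s) := fun s t ht => by
    rw [← ENNReal.ofReal_pow (Real.rpow_nonneg ht.1.le _), ← Real.rpow_natCast,
      ← Real.rpow_mul ht.1.le]
    norm_num
  refine le_trans (le_of_eq ?_) (hcs.trans (le_of_eq ?_))
  · congr 1
    refine setLIntegral_congr_fun measurableSet_Ioc fun t ht => ?_
    rw [← mul_assoc (ENNReal.ofReal _), ← ENNReal.ofReal_mul (Real.rpow_nonneg ht.1.le _),
      ← Real.rpow_add ht.1]
    simp [show (δ - 1) / 2 + (1 - δ) / 2 = 0 by ring]
  · congr 1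
    · exact setLIntegral_congr_fun measurableSet_Ioc fun t ht => hsq _ t ht
    · refine setLIntegral_congr_fun measurableSet_Ioc fun t ht => ?_
      simp only [mul_pow, hsq _ t ht]

theorem lintegral_comp_smul_sub {F : ℂ → ℝ≥0∞} (hF : Measurable F) {t : ℝ} (ht : 0 < t) (x : ℂ) :
    ∫⁻ y, F (t • (y - x)) = ENNReal.ofReal (t ^ (-2 : ℝ)) * ∫⁻ w, F w := by
  rw [lintegral_sub_right_eq_self (fun y => F (t • y)) x,
    ← lintegral_map (f := F) (g := fun y : ℂ => t • y) hF (measurable_const_smul t),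
    Measure.map_addHaar_smul volume ht.ne', lintegral_smul_measure, smul_eq_mul]
  congr 2
  rw [Complex.finrank_real_complex, abs_of_pos (by positivity), Real.rpow_neg ht.le]
  norm_cast

/-- The Riesz kernel `|w| ^ (-s)`. -/
noncomputable def rieszKernel (s : ℝ) (w : ℂ) : ℝ≥0∞ := ENNReal.ofReal (‖w‖ ^ (-s))

@[fun_prop]
theorem measurable_rieszKernel (s : ℝ) : Measurable (rieszKernel s) := by
  unfold rieszKernel; fun_prop

theorem rieszKernel_smul (s : ℝ) {t : ℝ} (ht : 0 < t) (w : ℂ) :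
    rieszKernel s w = ENNReal.ofReal (t ^ s) * rieszKernel s (t • w) := by
  rw [rieszKernel, rieszKernel, ← ENNReal.ofReal_mul (by positivity), norm_smul,
    Real.norm_of_nonneg ht.le, Real.mul_rpow ht.le (norm_nonneg _), ← mul_assoc,
    ← Real.rpow_add ht]
  simp

theorem enorm_sq_le_rieszKernel {s : ℝ} (hs : 0 ≤ s) {w : ℂ} (hw : ‖w‖ ≤ 2) :
    ‖w‖ₑ ^ 2 ≤ ENNReal.ofReal (2 ^ (2 + s)) * rieszKernel s w := by
  -- For s > 0 the kernel takes the value 0 at the origin, by the convention for real powers; the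
  -- left side vanishes there too.
  rcases eq_or_ne w 0 with rfl | h0
  · simp
  have hp : 0 < ‖w‖ := norm_pos_iff.2 h0
  rw [rieszKernel, ← ENNReal.ofReal_mul (by positivity), ← ofReal_norm,
    ← ENNReal.ofReal_pow (norm_nonneg _)]
  refine ENNReal.ofReal_le_ofReal ?_
  calc ‖w‖ ^ 2 = ‖w‖ ^ (2 + s) * ‖w‖ ^ (-s) := by
        rw [← Real.rpow_add hp]; norm_num
    _ ≤ 2 ^ (2 + s) * ‖w‖ ^ (-s) := by gcongr

/-- The substitution w = t (y - x) costs t^(-2). Weakening |y - x|² to a multiple of |y - x|^(-2δ)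
gains t^(2δ) by homogeneity, so together with t^(1-δ) the power is t^(δ-1), integrable at 0. This
gives the second factor `rpowIntegral δ`. -/
theorem lintegral_enorm_sub_sq_le {f : ℂ → ℝ} (hf : ContDiff ℝ 1 f) {δ : ℝ} (hδ : 0 < δ)
    {B S : Set ℂ} (hB : Convex ℝ B) (hBm : MeasurableSet B) (hSm : MeasurableSet S) (hSB : S ⊆ B)
    (hdiam : ∀ x ∈ B, ∀ y ∈ B, ‖y - x‖ ≤ 2) {x : ℂ} (hx : x ∈ B) :
    ∫⁻ y in S, ‖f y - f x‖ₑ ^ 2 ≤ ENNReal.ofReal (2 ^ (2 + 2 * δ)) * rpowIntegral δ ^ 2 *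
      ∫⁻ z in B, ‖fderiv ℝ f z‖ₑ ^ 2 * rieszKernel (2 * δ) (z - x) := by
  -- Extension by zero outside B lets y range over the whole plane, so the dilation changes no
  -- domain of integration; convexity keeps the segments from x to points of S inside B.
  set u : ℂ → ℝ≥0∞ := B.indicator fun z => ‖fderiv ℝ f z‖ₑ ^ 2 with hu
  have hum : Measurable u :=
    ((hf.continuous_fderiv (by simp)).enorm.measurable.pow_const 2).indicator hBm
  set C := ENNReal.ofReal (2 ^ (2 + 2 * δ)) with hC
  set J := ∫⁻ z in B, ‖fderiv ℝ f z‖ₑ ^ 2 * rieszKernel (2 * δ) (z - x) with hJ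
  have hJ' : J = ∫⁻ w, u (x + w) * rieszKernel (2 * δ) w := by
    rw [hJ, ← lintegral_indicator hBm, ← lintegral_add_left_eq_self _ x]
    refine lintegral_congr fun w => ?_
    simp only [hu, add_sub_cancel_left, indicator]
    split_ifs <;> simp
  have h1 : ∀ y ∈ S, ‖f y - f x‖ₑ ^ 2 ≤ rpowIntegral δ * ∫⁻ t in Ioc (0 : ℝ) 1,
      ENNReal.ofReal (t ^ (1 - δ)) * (u (x + t • (y - x)) *
        (C * rieszKernel (2 * δ) (y - x))) := by
    intro y hy
    refine (enorm_sub_sq_le_lintegral_fderiv hf δ x y).trans ?_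
    gcongr rpowIntegral δ * ?_
    refine setLIntegral_mono' measurableSet_Ioc fun t ht => ?_
    have hmem : x + t • (y - x) ∈ B := hB.add_smul_sub_mem hx (hSB hy) ⟨ht.1.le, ht.2⟩
    gcongr
    · rw [hu, indicator_of_mem hmem]
    · exact enorm_sq_le_rieszKernel (by positivity) (hdiam x hx y (hSB hy))
  have h2 : ∀ t ∈ Ioc (0 : ℝ) 1, ∫⁻ y, ENNReal.ofReal (t ^ (1 - δ)) * (u (x + t • (y - x)) *
        (C * rieszKernel (2 * δ) (y - x))) = C * J * ENNReal.ofReal (t ^ (δ - 1)) := by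
    intro t ht
    have e1 : ∀ y, ENNReal.ofReal (t ^ (1 - δ)) * (u (x + t • (y - x)) *
        (C * rieszKernel (2 * δ) (y - x))) =
        (fun w => C * ENNReal.ofReal (t ^ (1 + δ)) * (u (x + w) * rieszKernel (2 * δ) w))
          (t • (y - x)) := by
      intro y
      simp only
      rw [rieszKernel_smul (2 * δ) ht.1 (y - x), show 1 + δ = (1 - δ) + 2 * δ by ring,
        Real.rpow_add ht.1, ENNReal.ofReal_mul (Real.rpow_nonneg ht.1.le _)]
      ring
    have hm : Measurable fun w => u (x + w) * rieszKernel (2 * δ) w :=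
      (hum.comp (measurable_const_add x)).mul (measurable_rieszKernel _)
    have hpow : t ^ (δ - 1) = t ^ (-2 : ℝ) * t ^ (1 + δ) := by
      rw [← Real.rpow_add ht.1]; congr 1; ring
    have hm' : Measurable fun w => C * ENNReal.ofReal (t ^ (1 + δ)) *
        (u (x + w) * rieszKernel (2 * δ) w) := hm.const_mul _
    rw [lintegral_congr e1, lintegral_comp_smul_sub hm' ht.1, lintegral_const_mul _ hm, ← hJ',
      hpow, ENNReal.ofReal_mul (Real.rpow_nonneg ht.1.le _)]
    ring
  have hmeas : Measurable (Function.uncurry fun (y : ℂ) (t : ℝ) =>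
      ENNReal.ofReal (t ^ (1 - δ)) * (u (x + t • (y - x)) *
        (C * rieszKernel (2 * δ) (y - x)))) := by
    simp only [Function.uncurry_def]
    have : Measurable fun p : ℂ × ℝ => u (x + p.2 • (p.1 - x)) := hum.comp (by fun_prop)
    fun_prop
  calc ∫⁻ y in S, ‖f y - f x‖ₑ ^ 2
      ≤ ∫⁻ y in S, rpowIntegral δ * ∫⁻ t in Ioc (0 : ℝ) 1,
        ENNReal.ofReal (t ^ (1 - δ)) * (u (x + t • (y - x)) *
          (C * rieszKernel (2 * δ) (y - x))) := setLIntegral_mono' hSm h1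
    _ ≤ ∫⁻ y, rpowIntegral δ * ∫⁻ t in Ioc (0 : ℝ) 1,
        ENNReal.ofReal (t ^ (1 - δ)) * (u (x + t • (y - x)) *
          (C * rieszKernel (2 * δ) (y - x))) := setLIntegral_le_lintegral _ _
    _ = rpowIntegral δ * ∫⁻ t in Ioc (0 : ℝ) 1, ∫⁻ y,
        ENNReal.ofReal (t ^ (1 - δ)) * (u (x + t • (y - x)) *
          (C * rieszKernel (2 * δ) (y - x))) := by
      rw [lintegral_const_mul' _ _ (rpowIntegral_lt_top hδ).ne,
        lintegral_lintegral_swap hmeas.aemeasurable]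
    _ = rpowIntegral δ * ∫⁻ t in Ioc (0 : ℝ) 1, C * J * ENNReal.ofReal (t ^ (δ - 1)) := by
      rw [setLIntegral_congr_fun measurableSet_Ioc h2]
    _ = C * rpowIntegral δ ^ 2 * J := by
      rw [lintegral_const_mul _ (by fun_prop), ← rpowIntegral]
      ring

/-- A Poincaré inequality for smooth functions on a convex set, with respect to a measure whose
Riesz potential of order `2 δ` is bounded. -/
theorem lintegral_lintegral_enorm_sub_sq_le {f : ℂ → ℝ} (hf : ContDiff ℝ 1 f) {δ : ℝ} (hδ : 0 < δ)
    {B S : Set ℂ} (hB : Convex ℝ B) (hBm : MeasurableSet B) (hSm : MeasurableSet S) (hSB : S ⊆ B)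
    (hdiam : ∀ x ∈ B, ∀ y ∈ B, ‖y - x‖ ≤ 2) {μ : Measure ℂ} [SFinite μ] {M : ℝ≥0∞}
    (hM : ∀ z ∈ B, ∫⁻ x, rieszKernel (2 * δ) (z - x) ∂μ ≤ M) :
    ∫⁻ x in B, (∫⁻ y in S, ‖f y - f x‖ₑ ^ 2) ∂μ ≤
      ENNReal.ofReal (2 ^ (2 + 2 * δ)) * rpowIntegral δ ^ 2 * M *
        ∫⁻ z in B, ‖fderiv ℝ f z‖ₑ ^ 2 := by
  have hfm : Measurable fun z => ‖fderiv ℝ f z‖ₑ :=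
    (hf.continuous_fderiv (by simp)).enorm.measurable
  have hC : ENNReal.ofReal (2 ^ (2 + 2 * δ)) * rpowIntegral δ ^ 2 ≠ ⊤ :=
    ENNReal.mul_ne_top ENNReal.ofReal_ne_top (ENNReal.pow_ne_top (rpowIntegral_lt_top hδ).ne)
  refine (setLIntegral_mono' hBm fun x hx =>
    lintegral_enorm_sub_sq_le hf hδ hB hBm hSm hSB hdiam hx).trans ?_
  rw [lintegral_const_mul' _ _ hC, mul_assoc _ M]
  gcongr
  -- After the exchange, the integral in x involves only the kernel and is bounded by `hM`.
  rw [lintegral_lintegral_swap (by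
    simp only [Function.uncurry_def]
    have : Measurable fun p : ℂ × ℂ => ‖fderiv ℝ f p.2‖ₑ := hfm.comp measurable_snd
    have h2 : Measurable fun p : ℂ × ℂ => rieszKernel (2 * δ) (p.2 - p.1) :=
      (measurable_rieszKernel _).comp (by fun_prop)
    exact ((this.pow_const 2).mul h2).aemeasurable)]
  rw [← lintegral_const_mul _ (by fun_prop)]
  refine setLIntegral_mono' hBm fun z hz => ?_
  rw [lintegral_const_mul _ (by fun_prop), mul_comm]
  gcongr
  exact (setLIntegral_le_lintegral _ _).trans (hM z hz)

/-! ### Mollification of Sobolev functions -/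

section Mollify

variable {Ω S : Set ℂ} {f : ℂ → ℝ} {G : ℂ → ℂ}

/-- The mollification of `f`, cut off outside `S`. -/
noncomputable def mollify (b : ContDiffBump (0 : ℂ)) (S : Set ℂ) (f : ℂ → ℝ) : ℂ → ℝ :=
  convolution (b.normed volume) (S.indicator f) (ContinuousLinearMap.lsmul ℝ ℝ) volume

theorem contDiff_mollify (b : ContDiffBump (0 : ℂ)) (hS : MeasurableSet S)
    (hf : IntegrableOn f S) : ContDiff ℝ 1 (mollify b S f) :=
  b.hasCompactSupport_normed.contDiff_convolution_left _ (n := 1) b.contDiff_normed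
    (hf.integrable_indicator hS).locallyIntegrable

/-- Mollification commutes with the weak gradient. -/
theorem HasWeakGradient.fderiv_mollify (hΩ : IsOpen Ω) (hfG : HasWeakGradient Ω f G)
    (b : ContDiffBump (0 : ℂ)) (hS : MeasurableSet S) (hSΩ : S ⊆ Ω) (hf : IntegrableOn f S) {x : ℂ}
    (hx : Metric.closedBall x b.rOut ⊆ S) :
    fderiv ℝ (mollify b S f) x =
      innerSL ℝ (∫ z in Ω, b.normed volume (x - z) • G z) := by
  have hbc : HasCompactSupport (b.normed (volume : Measure ℂ)) := b.hasCompactSupport_normed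
  have hbd : ContDiff ℝ ∞ (b.normed (volume : Measure ℂ)) := b.contDiff_normed
  have hf0 := (hf.integrable_indicator hS).locallyIntegrable
  have hflip : mollify b S f = convolution (S.indicator f) (b.normed volume)
      (ContinuousLinearMap.lsmul ℝ ℝ) volume := by
    rw [mollify, ← convolution_flip]
    congr 1
    ext; simp
  -- The reflected and translated bump is an admissible test function, because its support lies in S
  -- ⊆ Ω.
  set η : ℂ → ℝ := fun z => b.normed volume (x - z) with hη
  have hηd : ContDiff ℝ ∞ η := hbd.comp (contDiff_const.sub contDiff_id)
  have h0 : ∀ z ∉ Metric.closedBall x b.rOut, η z = 0 := by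
    intro z hz
    have : x - z ∉ Function.support (b.normed (volume : Measure ℂ)) := by
      rw [b.support_normed_eq, Metric.mem_ball, dist_zero_right]
      rw [Metric.mem_closedBall, dist_comm, dist_eq_norm] at hz
      exact fun h => hz h.le
    simpa using this
  have hηt := tsupport_subset_of_eqOn_zero (isCompact_closedBall x b.rOut) h0
  have hηc : HasCompactSupport η :=
    (isCompact_closedBall x b.rOut).of_isClosed_subset (isClosed_tsupport _) hηt
  have hint : IntegrableOn (fun z => η z • G z) Ω :=
    hfG.locallyIntegrableOn_grad.integrableOn_smul_of_tsupport_subset hηd.continuous hηc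
      (hηt.trans (hx.trans hSΩ))
  have hfd : ∀ z v, fderiv ℝ η z v = - fderiv ℝ (b.normed (volume : Measure ℂ)) (x - z) v := by
    intro z v
    have h1 : HasFDerivAt (fun z : ℂ => x - z) (-ContinuousLinearMap.id ℝ ℂ) z :=
      (hasFDerivAt_id z).const_sub x
    have h2 : HasFDerivAt η ((fderiv ℝ (b.normed (volume : Measure ℂ)) (x - z)).comp
        (-ContinuousLinearMap.id ℝ ℂ)) z :=
      (hbd.differentiable (by simp) (x - z)).hasFDerivAt.comp z h1
    rw [h2.fderiv]
    simp
  ext1 v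
  rw [hflip, (hbc.hasFDerivAt_convolution_right _ hf0 (hbd.of_le (by simp)) x).fderiv,
    convolution_precompR_apply _ hf0 (hbc.fderiv ℝ) (hbd.continuous_fderiv (by simp)),
    convolution_def]
  have e1 : ∀ z, (ContinuousLinearMap.lsmul ℝ ℝ) (S.indicator f z)
      (fderiv ℝ (b.normed (volume : Measure ℂ)) (x - z) v) =
      Ω.indicator (fun z => -(f z * fderiv ℝ η z v)) z := by
    intro z
    have := hfd z v
    by_cases hz : z ∈ S
    · simp [hz, hSΩ hz, this]
    · have hd : fderiv ℝ η z = 0 := by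
        have : z ∉ tsupport (fderiv ℝ η) :=
          fun h => hz (hx (hηt (tsupport_fderiv_subset ℝ h)))
        exact image_eq_zero_of_notMem_tsupport this
      simp [hz, indicator, hd]
  simp_rw [e1]
  rw [integral_indicator hΩ.measurableSet, integral_neg, hfG.integral_eq η hηd hηc
    (hηt.trans (hx.trans hSΩ)) v, neg_neg, innerSL_apply_apply, real_inner_comm,
    ← integral_inner hint]
  refine integral_congr_ae (Eventually.of_forall fun z => ?_)
  simp only [inner_smul_right, real_inner_comm v]
  exact mul_comm _ _

theorem lintegral_normed_eq_one (b : ContDiffBump (0 : ℂ)) :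
    ∫⁻ z, ENNReal.ofReal (b.normed volume z) = 1 := by
  rw [← ofReal_integral_eq_lintegral_ofReal b.integrable_normed
    (Eventually.of_forall b.nonneg_normed), b.integral_normed, ENNReal.ofReal_one]

/-- Jensen's inequality for a bump of mass one, obtained from Cauchy–Schwarz by splitting the bump
into two square roots. -/
theorem HasWeakGradient.enorm_fderiv_mollify_sq_le (hΩ : IsOpen Ω) (hfG : HasWeakGradient Ω f G)
    (b : ContDiffBump (0 : ℂ)) (hS : MeasurableSet S) (hSΩ : S ⊆ Ω) (hf : IntegrableOn f S) {x : ℂ}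
    (hx : Metric.closedBall x b.rOut ⊆ S) :
    ‖fderiv ℝ (mollify b S f) x‖ₑ ^ 2 ≤
      ∫⁻ z in Ω, ENNReal.ofReal (b.normed volume (x - z)) * ‖G z‖ₑ ^ 2 := by
  have hGm : AEMeasurable (fun z => ‖G z‖ₑ) (volume.restrict Ω) :=
    hfG.locallyIntegrableOn_grad.aestronglyMeasurable.enorm
  have hbm : Measurable fun z => ENNReal.ofReal (b.normed volume (x - z)) :=
    (b.continuous_normed.measurable.comp (measurable_const.sub measurable_id)).ennreal_ofReal
  have h1 : ‖fderiv ℝ (mollify b S f) x‖ₑ ≤ ∫⁻ z in Ω,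
      ENNReal.ofReal (b.normed volume (x - z)) ^ (1 / 2 : ℝ) *
        (ENNReal.ofReal (b.normed volume (x - z)) ^ (1 / 2 : ℝ) * ‖G z‖ₑ) := by
    rw [hfG.fderiv_mollify hΩ b hS hSΩ hf hx, ← ofReal_norm, innerSL_apply_norm, ofReal_norm]
    refine (enorm_integral_le_lintegral_enorm _).trans (lintegral_mono fun z => le_of_eq ?_)
    rw [enorm_smul, ← mul_assoc, ← ENNReal.rpow_add_of_nonneg _ _ (by norm_num) (by norm_num),
      Real.enorm_of_nonneg (b.nonneg_normed _)]
    norm_num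
  have hsq : ∀ a : ℝ≥0∞, (a ^ (1 / 2 : ℝ)) ^ 2 = a := fun a => by
    rw [← ENNReal.rpow_two, ← ENNReal.rpow_mul]; norm_num
  have h2 := lintegral_mul_sq_le (μ := volume.restrict Ω)
    (a := fun z => ENNReal.ofReal (b.normed volume (x - z)) ^ (1 / 2 : ℝ))
    (b := fun z => ENNReal.ofReal (b.normed volume (x - z)) ^ (1 / 2 : ℝ) * ‖G z‖ₑ)
    (hbm.pow_const _).aemeasurable ((hbm.pow_const _).aemeasurable.mul hGm)
  simp only [mul_pow, hsq] at h2
  have h3 : ∫⁻ z in Ω, ENNReal.ofReal (b.normed volume (x - z)) ≤ 1 := by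
    refine (setLIntegral_le_lintegral _ _).trans_eq ?_
    rw [lintegral_sub_left_eq_self (fun z => ENNReal.ofReal (b.normed volume z)) x,
      lintegral_normed_eq_one]
  calc _ ≤ _ := pow_le_pow_left₀ zero_le h1 2
    _ ≤ _ := h2
    _ ≤ 1 * ∫⁻ z in Ω, ENNReal.ofReal (b.normed volume (x - z)) * ‖G z‖ₑ ^ 2 := by gcongr
    _ = _ := one_mul _

/-- The bump also has mass at most one in the variable x, so Tonelli gives a bound independent of
its radius. -/
theorem HasWeakGradient.lintegral_fderiv_mollify_le (hΩ : IsOpen Ω) (hfG : HasWeakGradient Ω f G)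
    (b : ContDiffBump (0 : ℂ)) (hS : MeasurableSet S) (hSΩ : S ⊆ Ω) (hf : IntegrableOn f S)
    {B : Set ℂ} (hB : MeasurableSet B) (hx : ∀ x ∈ B, Metric.closedBall x b.rOut ⊆ S) :
    ∫⁻ x in B, ‖fderiv ℝ (mollify b S f) x‖ₑ ^ 2 ≤ ∫⁻ z in Ω, ‖G z‖ₑ ^ 2 := by
  have hGm : AEMeasurable (fun z => ‖G z‖ₑ) (volume.restrict Ω) :=
    hfG.locallyIntegrableOn_grad.aestronglyMeasurable.enorm
  have hbm : Measurable fun p : ℂ × ℂ => ENNReal.ofReal (b.normed volume (p.1 - p.2)) :=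
    (b.continuous_normed.measurable.comp (measurable_fst.sub measurable_snd)).ennreal_ofReal
  refine (setLIntegral_mono' hB fun x hxB =>
    hfG.enorm_fderiv_mollify_sq_le hΩ b hS hSΩ hf (hx x hxB)).trans ?_
  have hm : AEMeasurable (Function.uncurry fun x z : ℂ =>
      ENNReal.ofReal (b.normed volume (x - z)) * ‖G z‖ₑ ^ 2)
        ((volume.restrict B).prod (volume.restrict Ω)) := by
    have : AEMeasurable (fun p : ℂ × ℂ => ‖G p.2‖ₑ)
      ((volume.restrict B).prod (volume.restrict Ω)) := hGm.comp_snd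
    exact hbm.aemeasurable.mul (this.pow_const 2)
  rw [lintegral_lintegral_swap hm]
  refine lintegral_mono fun z => ?_
  have hbz : Measurable fun x => ENNReal.ofReal (b.normed volume (x - z)) :=
    (b.continuous_normed.measurable.comp (measurable_id.sub measurable_const)).ennreal_ofReal
  have h3 : ∫⁻ x in B, ENNReal.ofReal (b.normed volume (x - z)) ≤ 1 := by
    refine (setLIntegral_le_lintegral _ _).trans_eq ?_
    rw [lintegral_sub_right_eq_self (fun z => ENNReal.ofReal (b.normed volume z)) z,
      lintegral_normed_eq_one]
  rw [lintegral_mul_const _ hbz]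
  exact (mul_le_mul_left h3 _).trans_eq (one_mul _)

end Mollify

/-! ### From smooth to Sobolev functions on smaller discs -/

/-- Passage to the limit in the inequality for smooth functions. -/
theorem HasWeakGradient.lintegral_lintegral_enorm_sub_sq_le {f : ℂ → ℝ} {G : ℂ → ℂ}
    (hfG : HasWeakGradient unitDisc f G) {δ : ℝ} (hδ : 0 < δ) {μ : Measure ℂ} [SFinite μ]
    (hμ : μ ≪ volume) {M : ℝ≥0∞}
    (hM : ∀ z ∈ unitDisc, ∫⁻ x, rieszKernel (2 * δ) (z - x) ∂μ ≤ M) {r : ℝ} (hr : r < 1)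
    {S : Set ℂ} (hS : MeasurableSet S) (hSr : S ⊆ Metric.ball 0 r) :
    ∫⁻ x in Metric.ball 0 r, (∫⁻ y in S, ‖f y - f x‖ₑ ^ 2) ∂μ ≤
      ENNReal.ofReal (2 ^ (2 + 2 * δ)) * rpowIntegral δ ^ 2 * M *
        ∫⁻ z in unitDisc, ‖G z‖ₑ ^ 2 := by
  -- The ring between the radii r and R leaves room for the supports of the bumps.
  set R := (1 + r) / 2 with hR
  have hrR : r < R := by rw [hR]; linarith
  have hR1 : R < 1 := by rw [hR]; linarith
  set T : Set ℂ := Metric.closedBall 0 R with hT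
  have hTD : T ⊆ unitDisc := Metric.closedBall_subset_ball hR1
  have hfT : IntegrableOn f T :=
    hfG.locallyIntegrableOn.integrableOn_compact_subset hTD (isCompact_closedBall _ _)
  have hBT : Metric.ball (0 : ℂ) r ⊆ T := (Metric.ball_subset_ball hrR.le).trans
    Metric.ball_subset_closedBall
  set b : ℕ → ContDiffBump (0 : ℂ) := fun n =>
    ⟨(R - r) / (n + 1) / 2, (R - r) / (n + 1), by
      have := sub_pos.2 hrR; positivity, half_lt_self (by have := sub_pos.2 hrR; positivity)⟩
    with hb
  have hbT : ∀ n, ∀ x ∈ Metric.ball (0 : ℂ) r, Metric.closedBall x (b n).rOut ⊆ T := by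
    intro n x hx
    refine Metric.closedBall_subset_closedBall' ?_
    rw [Metric.mem_ball] at hx
    have : (b n).rOut ≤ R - r := div_le_self (sub_pos.2 hrR).le (by simp)
    linarith
  have hb0 : Tendsto (fun n => (b n).rOut) atTop (𝓝 0) :=
    tendsto_const_nhds.div_atTop (tendsto_natCast_atTop_atTop.atTop_add tendsto_const_nhds)
  set F : ℕ → ℂ → ℝ := fun n => mollify (b n) T f with hF
  have hFc : ∀ n, ContDiff ℝ 1 (F n) := fun n => contDiff_mollify _ measurableSet_closedBall hfT
  have hlim : ∀ᵐ x, x ∈ Metric.ball (0 : ℂ) r → Tendsto (fun n => F n x) atTop (𝓝 (f x)) := by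
    -- The bound 2 is the fixed ratio of outer to inner radius of the bumps.
    have := ContDiffBump.ae_convolution_tendsto_right_of_locallyIntegrable (μ := volume)
      (K := 2) hb0
      (Eventually.of_forall fun n => by simp only [hb]; linarith)
      (hfT.integrable_indicator measurableSet_closedBall).locallyIntegrable
    filter_upwards [this] with x hx hxr
    rwa [indicator_of_mem (hBT hxr)] at hx
  have hFm : ∀ n, Measurable fun p : ℂ × ℂ => ‖F n p.2 - F n p.1‖ₑ ^ 2 := fun n => by
    have := (hFc n).continuous
    have h2 : Continuous fun p : ℂ × ℂ => ‖F n p.2 - F n p.1‖ₑ := by fun_prop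
    exact h2.measurable.pow_const 2
  have hFm1 : ∀ n x, Measurable fun y : ℂ => ‖F n y - F n x‖ₑ ^ 2 := fun n x => by
    have := (hFc n).continuous
    have h2 : Continuous fun y : ℂ => ‖F n y - F n x‖ₑ := by fun_prop
    exact h2.measurable.pow_const 2
  have hFm2 : ∀ n, Measurable fun x : ℂ => ∫⁻ y in S, ‖F n y - F n x‖ₑ ^ 2 := fun n =>
    (hFm n).lintegral_prod_right'
  -- Fatou in y for fixed x; `hμ` makes the almost everywhere convergence hold μ-almost everywhere
  -- in x. A second use of Fatou, in x, follows.
  have hinner : ∀ᵐ x ∂(μ.restrict (Metric.ball 0 r)), ∫⁻ y in S, ‖f y - f x‖ₑ ^ 2 ≤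
      liminf (fun n => ∫⁻ y in S, ‖F n y - F n x‖ₑ ^ 2) atTop := by
    filter_upwards [ae_restrict_mem measurableSet_ball, ae_restrict_of_ae (hμ.ae_le hlim)]
      with x hx hxl
    refine le_trans (le_of_eq ?_) (lintegral_liminf_le fun n => hFm1 n x)
    refine lintegral_congr_ae ?_
    filter_upwards [ae_restrict_mem hS, ae_restrict_of_ae hlim] with y hy hyl
    refine (Tendsto.liminf_eq ?_).symm
    exact ((ENNReal.continuous_pow 2).tendsto _).comp
      (((hyl (hSr hy)).sub (hxl hx)).enorm)
  refine (lintegral_mono_ae hinner).trans ((lintegral_liminf_le hFm2).trans ?_)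
  refine liminf_le_of_frequently_le' (Frequently.of_forall fun n => ?_)
  refine (_root_.lintegral_lintegral_enorm_sub_sq_le (hFc n) hδ (convex_ball 0 r)
    measurableSet_ball hS hSr (fun x hx y hy => ?_) (fun z hz => hM z (hTD (hBT hz)))).trans ?_
  · rw [mem_ball_zero_iff] at hx hy
    linarith [norm_sub_le y x]
  · refine mul_le_mul' le_rfl ?_
    exact hfG.lintegral_fderiv_mollify_le Metric.isOpen_ball (b n) measurableSet_closedBall hTD hfT
      measurableSet_ball (hbT n)

theorem eLpNorm_two_eq {X E : Type*} [MeasurableSpace X] [NormedAddCommGroup E] (μ : Measure X)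
    (f : X → E) : eLpNorm f 2 μ = (∫⁻ x, ‖f x‖ₑ ^ 2 ∂μ) ^ (1 / 2 : ℝ) := by
  rw [eLpNorm_eq_lintegral_rpow_enorm_toReal (by simp) (by simp)]
  simp

theorem isOpen_unitDisc : IsOpen unitDisc := Metric.isOpen_ball

instance isFiniteMeasure_restrict_unitDisc : IsFiniteMeasure (volume.restrict unitDisc) :=
  ⟨by
    rw [Measure.restrict_apply_univ]
    exact measure_ball_lt_top⟩

/-! ### Boundedness of the Riesz potential of the weight -/

section RieszPotential

theorem rieszKernel_rpow (s : ℝ) {p : ℝ} (hp : 0 ≤ p) (w : ℂ) :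
    rieszKernel s w ^ p = rieszKernel (s * p) w := by
  rw [rieszKernel, rieszKernel, ENNReal.ofReal_rpow_of_nonneg (by positivity) hp,
    ← Real.rpow_mul (norm_nonneg _), neg_mul]

/-- In polar coordinates the area element r dr cancels the singularity r⁻¹. -/
theorem lintegral_rieszKernel_one_lt_top :
    ∫⁻ w in Metric.ball (0 : ℂ) 2, rieszKernel 1 w < ⊤ := by
  have h : IntegrableOn (fun w : ℂ => ‖w‖ ^ (-1 : ℝ)) (Metric.ball (0 : ℂ) 2) := by
    rw [integrableOn_fun_norm_addHaar volume (f := fun y => y ^ (-1 : ℝ))]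
    have h1 : IntegrableOn (fun _ : ℝ => (1 : ℝ)) (Ioo 0 2) := by simp
    refine h1.congr_fun (fun y hy => ?_) measurableSet_Ioo
    have : y ≠ 0 := hy.1.ne'
    simp [Complex.finrank_real_complex, Real.rpow_neg_one, this]
  exact h.lintegral_lt_top

theorem lintegral_rieszKernel_sub_le {z : ℂ} (hz : z ∈ unitDisc) :
    ∫⁻ x in unitDisc, rieszKernel 1 (z - x) ≤ ∫⁻ w in Metric.ball (0 : ℂ) 2, rieszKernel 1 w := by
  rw [← lintegral_indicator isOpen_unitDisc.measurableSet,
    ← lintegral_indicator measurableSet_ball,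
    ← lintegral_sub_left_eq_self ((Metric.ball (0 : ℂ) 2).indicator (rieszKernel 1)) z]
  refine lintegral_mono fun x => indicator_apply_le' (fun hx => ?_) fun _ => zero_le
  have : z - x ∈ Metric.ball (0 : ℂ) 2 := by
    rw [unitDisc, mem_ball_zero_iff] at hz hx
    rw [mem_ball_zero_iff]
    linarith [norm_sub_le z x]
  rw [indicator_of_mem this]

/-- If `ψ' ∈ L^α(𝔻)` with `α > 2`, then some Riesz potential of the weight `|ψ'|²` is bounded. -/
theorem exists_rieszPotential_le {α : ℝ≥0∞} (hα : 2 < α) {ψ : ℂ → ℂ}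
    (hψ : MemLp (deriv ψ) α (volume.restrict unitDisc)) :
    ∃ δ : ℝ, 0 < δ ∧ ∃ M : ℝ≥0∞, M ≠ ⊤ ∧ ∀ z ∈ unitDisc,
      ∫⁻ x, rieszKernel (2 * δ) (z - x) ∂(weightMeasure unitDisc (conformalWeight ψ)) ≤ M := by
  -- A finite exponent q is chosen because α may be ∞; the weight then lies in L^p with p = q/2 > 1.
  obtain ⟨q, hq2, hqα⟩ : ∃ q : ℝ≥0, 2 < q ∧ (q : ℝ≥0∞) ≤ α := by
    obtain ⟨q, h1, h2⟩ := ENNReal.lt_iff_exists_nnreal_btwn.1 hα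
    exact ⟨q, by exact_mod_cast h1, h2.le⟩
  have hψq := hψ.mono_exponent hqα
  set p : ℝ := q / 2 with hp
  have hp1 : 1 < p := by
    have : (2 : ℝ) < q := by exact_mod_cast hq2
    rw [hp]; linarith
  have hpq : p.HolderConjugate p.conjExponent := Real.HolderConjugate.conjExponent hp1
  set p' := p.conjExponent
  have hp'0 : 0 < p' := hpq.symm.pos
  set H : ℂ → ℝ≥0∞ := fun z => ENNReal.ofReal (conformalWeight ψ z) with hH
  have hHe : ∀ z, H z = ‖deriv ψ z‖ₑ ^ (2 : ℝ) := fun z => by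
    rw [hH]
    simp only [conformalWeight]
    rw [ENNReal.ofReal_pow (norm_nonneg _), ofReal_norm, ENNReal.rpow_two]
  have hHm : AEMeasurable H (volume.restrict unitDisc) := by
    simp_rw [funext hHe]
    exact hψ.1.enorm.pow_const _
  have hHp : ∫⁻ z in unitDisc, H z ^ p < ⊤ := by
    have := lintegral_rpow_enorm_lt_top_of_eLpNorm_lt_top
      (by exact_mod_cast (zero_lt_two.trans hq2).ne') ENNReal.coe_ne_top hψq.2
    refine lt_of_le_of_lt (le_of_eq (lintegral_congr fun z => ?_)) this
    rw [hHe, ← ENNReal.rpow_mul, hp, ENNReal.coe_toReal]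
    congr 1; ring
  -- With 2δp' = 1 the p'-th power of the kernel in Hölder's inequality is |w|⁻¹.
  refine ⟨1 / (2 * p'), by positivity, (∫⁻ z in unitDisc, H z ^ p) ^ (1 / p) *
    (∫⁻ w in Metric.ball (0 : ℂ) 2, rieszKernel 1 w) ^ (1 / p'), ?_, fun z hz => ?_⟩
  · exact ENNReal.mul_ne_top (ENNReal.rpow_ne_top_of_nonneg (by positivity) hHp.ne)
      (ENNReal.rpow_ne_top_of_nonneg (by positivity) lintegral_rieszKernel_one_lt_top.ne)
  · have hk : Measurable fun x => rieszKernel (2 * (1 / (2 * p'))) (z - x) :=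
      (measurable_rieszKernel _).comp (measurable_const.sub measurable_id)
    rw [weightMeasure, lintegral_withDensity_eq_lintegral_mul₀ hHm hk.aemeasurable]
    refine (ENNReal.lintegral_mul_le_Lp_mul_Lq _ hpq hHm hk.aemeasurable).trans ?_
    refine mul_le_mul' le_rfl (ENNReal.rpow_le_rpow ?_ (by positivity))
    refine le_trans (le_of_eq (lintegral_congr fun x => ?_)) (lintegral_rieszKernel_sub_le hz)
    rw [rieszKernel_rpow _ hp'0.le]
    congr 1
    field_simp

end RieszPotential

/-! ### Mean values and the weighted Poincaré inequality on the disc -/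

theorem enorm_sub_average_sq_mul_le {S : Set ℂ} {f : ℂ → ℝ}
    (h0 : volume S ≠ 0) (ht : volume S ≠ ⊤) (hf : IntegrableOn f S) (a : ℝ) :
    ‖a - (volume.real S)⁻¹ * ∫ y in S, f y‖ₑ ^ 2 ≤
      (volume S)⁻¹ * ∫⁻ y in S, ‖f y - a‖ₑ ^ 2 := by
  have hfin : IsFiniteMeasure (volume.restrict S) := ⟨by simpa using ht.lt_top⟩
  have hv : volume.real S ≠ 0 := (ENNReal.toReal_pos h0 ht).ne'
  set c := (volume.real S)⁻¹ * ∫ y in S, f y with hc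
  have h1 : volume.real S * (c - a) = ∫ y in S, (f y - a) := by
    rw [integral_sub hf (integrable_const a), setIntegral_const, hc, smul_eq_mul]
    field_simp
  have h2 : volume S * ‖a - c‖ₑ ≤ ∫⁻ y in S, ‖f y - a‖ₑ * 1 := by
    have : volume S * ‖a - c‖ₑ = ‖volume.real S * (c - a)‖ₑ := by
      rw [enorm_mul, Real.enorm_of_nonneg measureReal_nonneg, Measure.real,
        ENNReal.ofReal_toReal ht, ← enorm_neg, neg_sub]
    rw [this, h1]
    simpa using enorm_integral_le_lintegral_enorm _
  have h3 := lintegral_mul_sq_le (μ := volume.restrict S) (a := fun y => ‖f y - a‖ₑ)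
    (b := fun _ => 1) (hf.1.sub aestronglyMeasurable_const).enorm aemeasurable_const
  simp only [one_pow, lintegral_const, Measure.restrict_apply_univ, one_mul] at h3
  have h4 := (pow_le_pow_left₀ zero_le h2 2).trans h3
  rw [mul_pow, sq (volume S), mul_comm (∫⁻ _ in S, _) (volume S), mul_assoc,
    ENNReal.mul_le_mul_iff_right h0 ht] at h4
  rw [mul_comm]
  rw [← div_eq_mul_inv, ENNReal.le_div_iff_mul_le (Or.inl h0) (Or.inl ht), mul_comm]
  exact h4

/-- Up to a factor `2`, the mean value is the best constant in `L²`. -/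
theorem eLpNorm_sub_average_le {X : Type*} [MeasurableSpace X] {μ : Measure X} [IsFiniteMeasure μ]
    {f : X → ℝ} (hf : MemLp f 2 μ) (h0 : μ univ ≠ 0) (c : ℝ) :
    eLpNorm (fun x => f x - (μ.real univ)⁻¹ * ∫ x, f x ∂μ) 2 μ ≤
      2 * eLpNorm (fun x => f x - c) 2 μ := by
  set m := (μ.real univ)⁻¹ * ∫ x, f x ∂μ with hm
  have ht : μ univ ≠ ⊤ := measure_ne_top μ univ
  have hv : μ.real univ ≠ 0 := (ENNReal.toReal_pos h0 ht).ne'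
  have hfi : Integrable f μ := hf.integrable (by norm_num)
  have hfc : AEStronglyMeasurable (fun x => f x - c) μ := hf.1.sub aestronglyMeasurable_const
  set E := eLpNorm (fun x => f x - c) 2 μ with hE
  -- Since c - m is the mean of c - f, its L² norm is at most that of f - c; the triangle inequality
  -- then gives the factor 2.
  have h1 : μ.real univ * (c - m) = - ∫ x, (f x - c) ∂μ := by
    rw [integral_sub hfi (integrable_const c), integral_const, hm, smul_eq_mul]
    field_simp
    ring
  have h2 : μ univ * ‖c - m‖ₑ ≤ E * μ univ ^ (1 / 2 : ℝ) := by
    have e : μ univ * ‖c - m‖ₑ = ‖μ.real univ * (c - m)‖ₑ := by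
      rw [enorm_mul, Real.enorm_of_nonneg measureReal_nonneg, Measure.real,
        ENNReal.ofReal_toReal ht]
    rw [e, h1, enorm_neg]
    refine (enorm_integral_le_lintegral_enorm _).trans ?_
    rw [← eLpNorm_one_eq_lintegral_enorm]
    refine (eLpNorm_le_eLpNorm_mul_rpow_measure_univ (q := 2) (by norm_num) hfc).trans
      (le_of_eq ?_)
    norm_num [hE]
  have h3 : ‖c - m‖ₑ * μ univ ^ (1 / 2 : ℝ) ≤ E := by
    have hs0 : μ univ ^ (1 / 2 : ℝ) ≠ 0 := by simp [h0]
    have hst : μ univ ^ (1 / 2 : ℝ) ≠ ⊤ := ENNReal.rpow_ne_top_of_nonneg (by norm_num) ht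
    rw [← ENNReal.mul_le_mul_iff_left hs0 hst]
    refine le_trans (le_of_eq ?_) h2
    rw [mul_assoc, ← ENNReal.rpow_add_of_nonneg _ _ (by norm_num) (by norm_num), mul_comm]
    norm_num
  have h4 : (fun x => f x - m) = (fun x => f x - c) + fun _ => c - m := by
    ext x; simp
  rw [h4, two_mul]
  refine (eLpNorm_add_le hfc aestronglyMeasurable_const (by norm_num)).trans ?_
  gcongr
  rw [eLpNorm_const _ (by norm_num) (by intro h; simp [h] at h0)]
  simpa using h3

theorem integral_weightMeasure {U : Set ℂ} {φ : ℂ → ℂ} {V : Set ℂ}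
    (h : IsConformalOnto φ U V) (hU : IsOpen U) (f : ℂ → ℝ) :
    ∫ z, f z ∂(weightMeasure U (conformalWeight φ)) = ∫ z in U, f z * conformalWeight φ z := by
  have hm := ((h.continuousOn_conformalWeight hU).aemeasurable (μ := volume)
    hU.measurableSet).ennreal_ofReal
  rw [weightMeasure, integral_withDensity_eq_integral_toReal_smul₀ hm (by simp)]
  refine integral_congr_ae (Eventually.of_forall fun z => ?_)
  simp only [smul_eq_mul]
  rw [ENNReal.toReal_ofReal (show 0 ≤ conformalWeight φ z from sq_nonneg _), mul_comm]

theorem weightedMeanValue_eq {U : Set ℂ} {φ : ℂ → ℂ} {V : Set ℂ}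
    (h : IsConformalOnto φ U V) (hU : IsOpen U) (f : ℂ → ℝ) :
    weightedMeanValue U (conformalWeight φ) f =
      ((weightMeasure U (conformalWeight φ)).real univ)⁻¹ *
        ∫ z, f z ∂(weightMeasure U (conformalWeight φ)) := by
  rw [weightedMeanValue, integral_weightMeasure h hU]
  congr 2
  have := integral_weightMeasure h hU fun _ => 1
  simpa using this.symm

/-- The radii start at 1/2, so every disc of the exhaustion contains the fixed disc of radius 1/2
used below. -/
theorem unitDisc_eq_iUnion : unitDisc = ⋃ n : ℕ, Metric.ball (0 : ℂ) (1 - 1 / (n + 2)) := by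
  ext z
  simp only [unitDisc, mem_iUnion, mem_ball_zero_iff]
  constructor
  · intro hz
    obtain ⟨n, hn⟩ := exists_nat_one_div_lt (sub_pos.2 hz)
    refine ⟨n, ?_⟩
    have : (1 : ℝ) / (n + 2) ≤ 1 / (n + 1) := by gcongr; norm_num
    linarith
  · rintro ⟨n, hn⟩
    have : (0 : ℝ) < 1 / (n + 2) := by positivity
    linarith

/-- The weighted Poincaré inequality on the disc for the derivative of a conformal map in
`L^α`, `α > 2`. -/
theorem weightedPoincareConstants_nonempty {α : ℝ≥0∞} (hα : 2 < α) {ψ : ℂ → ℂ} {Ω : Set ℂ}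
    (h : IsConformalOnto ψ unitDisc Ω) (hψ : MemLp (deriv ψ) α (volume.restrict unitDisc))
    (hfin : volume Ω ≠ ⊤) (hpos : volume Ω ≠ 0) :
    (weightedPoincareConstants unitDisc (conformalWeight ψ)).Nonempty := by
  obtain ⟨δ, hδ, M, hM, hMz⟩ := exists_rieszPotential_le hα hψ
  have hU := isOpen_unitDisc
  have hμfin := h.isFiniteMeasure_weightMeasure hU hfin
  have hμac := IsConformalOnto.weightMeasure_absolutelyContinuous ψ unitDisc
  have hμ0 : weightMeasure unitDisc (conformalWeight ψ) univ ≠ 0 := by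
    intro h0
    apply hpos
    have := h.map_weightMeasure hU
    rw [Measure.measure_univ_eq_zero.1 h0, Measure.map_zero] at this
    simpa using congrArg (fun ν : Measure ℂ => ν univ) this.symm
  set μ := weightMeasure unitDisc (conformalWeight ψ)
  set A := ENNReal.ofReal (2 ^ (2 + 2 * δ)) * rpowIntegral δ ^ 2 * M with hA
  have hAt : A ≠ ⊤ := ENNReal.mul_ne_top (ENNReal.mul_ne_top ENNReal.ofReal_ne_top
    (ENNReal.pow_ne_top (rpowIntegral_lt_top hδ).ne)) hM
  -- f is first compared with its unweighted mean over a relatively compact disc, where local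
  -- integrability suffices.
  set S : Set ℂ := Metric.ball 0 (1 / 2) with hS
  have hS0 : volume S ≠ 0 := (Metric.measure_ball_pos volume 0 (by norm_num)).ne'
  have hSt : volume S ≠ ⊤ := measure_ball_lt_top.ne
  -- The 2 comes from replacing the mean over S by the weighted mean, |S|⁻¹ from Jensen's
  -- inequality, and A from the double integral.
  set B := 2 * ((volume S)⁻¹ * A) ^ (1 / 2 : ℝ) with hB
  have hBt : B ≠ ⊤ := ENNReal.mul_ne_top (by norm_num)
    (ENNReal.rpow_ne_top_of_nonneg (by norm_num) (ENNReal.mul_ne_top (by simpa using hS0) hAt))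
  refine ⟨B.toNNReal, fun f G hf => ?_⟩
  rw [ENNReal.coe_toNNReal hBt, weightedMeanValue_eq h hU]
  have hfS : IntegrableOn f S :=
    (hf.hasWeakGradient.locallyIntegrableOn.integrableOn_compact_subset
      (Metric.closedBall_subset_ball (by norm_num)) (isCompact_closedBall 0 (1 / 2))).mono_set
      Metric.ball_subset_closedBall
  set c := (volume.real S)⁻¹ * ∫ y in S, f y
  have hr : ∀ n : ℕ, (1 : ℝ) / 2 ≤ 1 - 1 / (n + 2) := fun n => by
    have : (1 : ℝ) / (n + 2) ≤ 1 / 2 := by gcongr; simp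
    linarith
  have hΦ : ∫⁻ x, (∫⁻ y in S, ‖f y - f x‖ₑ ^ 2) ∂μ ≤ A * ∫⁻ z in unitDisc, ‖G z‖ₑ ^ 2 := by
    have hμD : μ.restrict unitDisc = μ := Measure.restrict_eq_self_of_ae_mem
      (hμac.ae_le (ae_restrict_mem hU.measurableSet))
    rw [← hμD, unitDisc_eq_iUnion, setLIntegral_iUnion_of_directed, ← unitDisc_eq_iUnion]
    · refine iSup_le fun n => ?_
      refine hf.hasWeakGradient.lintegral_lintegral_enorm_sub_sq_le hδ
        (hμac.trans Measure.restrict_le_self.absolutelyContinuous) hMz ?_ measurableSet_ball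
        (Metric.ball_subset_ball (hr n))
      have : (0 : ℝ) < 1 / (n + 2) := by positivity
      linarith
    · refine (monotone_nat_of_le_succ fun n => Metric.ball_subset_ball ?_).directed_le
      push_cast
      gcongr
      linarith
  refine (eLpNorm_sub_average_le hf.memLp hμ0 c).trans ?_
  rw [hB, mul_assoc, eLpNorm_two_eq, eLpNorm_two_eq,
    ← ENNReal.mul_rpow_of_nonneg _ _ (by norm_num : (0 : ℝ) ≤ 1 / 2)]
  gcongr
  calc ∫⁻ x, ‖f x - c‖ₑ ^ 2 ∂μ
      ≤ ∫⁻ x, (volume S)⁻¹ * (∫⁻ y in S, ‖f y - f x‖ₑ ^ 2) ∂μ :=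
        lintegral_mono fun x => enorm_sub_average_sq_mul_le hS0 hSt hfS (f x)
    _ = (volume S)⁻¹ * ∫⁻ x, (∫⁻ y in S, ‖f y - f x‖ₑ ^ 2) ∂μ :=
        lintegral_const_mul' _ _ (by simpa using hS0)
    _ ≤ (volume S)⁻¹ * A * ∫⁻ z in unitDisc, ‖G z‖ₑ ^ 2 := by
        rw [mul_assoc]; gcongr

/-! ### Finiteness of the area, convergence of the mean values, and the conclusion -/

theorem IsConformalRegular.volume_lt_top {α : ℝ≥0∞} {Ω : Set ℂ} (hΩ : IsConformalRegular α Ω) :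
    volume Ω < ⊤ := by
  obtain ⟨hα, ψ, hψ, hL⟩ := hΩ
  have h2 := lintegral_rpow_enorm_lt_top_of_eLpNorm_lt_top (by simp) (by simp)
    (hL.mono_exponent hα.le).2
  have h1 := hψ.lintegral_eq isOpen_unitDisc fun _ => 1
  simp only [lintegral_one, Measure.restrict_apply_univ, mul_one] at h1
  rw [h1]
  refine lt_of_le_of_lt (le_of_eq (lintegral_congr fun z => ?_)) h2
  rw [conformalWeight, ENNReal.ofReal_pow (norm_nonneg _), ofReal_norm]
  simp

theorem IsConformalOnto.integrableOn_conformalWeight {φ : ℂ → ℂ} {U V : Set ℂ}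
    (h : IsConformalOnto φ U V) (hU : IsOpen U) (hfin : volume V ≠ ⊤) :
    IntegrableOn (conformalWeight φ) U := by
  have h1 := h.integrableOn_image_iff hU subset_rfl hU.measurableSet fun _ => (1 : ℝ)
  rw [h.image_eq] at h1
  simpa using h1.1 (by simp [hfin.lt_top])

theorem IsConformalOnto.integral_conformalWeight {φ : ℂ → ℂ} {U V : Set ℂ}
    (h : IsConformalOnto φ U V) (hU : IsOpen U) :
    ∫ z in U, conformalWeight φ z = volume.real V := by
  have := h.integral_eq hU (fun _ => (1 : ℝ))
  simpa using this.symm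

theorem IsConformalOnto.integrableOn_mul_conformalWeight {φ : ℂ → ℂ} {U V : Set ℂ}
    (h : IsConformalOnto φ U V) (hU : IsOpen U) (hfin : volume V ≠ ⊤) {f : ℂ → ℝ}
    (hf : MemLp f 2 (weightMeasure U (conformalWeight φ))) :
    IntegrableOn (fun z => f z * conformalWeight φ z) U := by
  have := h.isFiniteMeasure_weightMeasure hU hfin
  have hi : Integrable f (weightMeasure U (conformalWeight φ)) := hf.integrable (by norm_num)
  have hm := ((h.continuousOn_conformalWeight hU).aemeasurable (μ := volume)
    hU.measurableSet).ennreal_ofReal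
  rw [weightMeasure, integrable_withDensity_iff_integrable_smul₀' hm (by simp)] at hi
  refine hi.congr (Eventually.of_forall fun z => ?_)
  simp only [smul_eq_mul]
  rw [ENNReal.toReal_ofReal (show 0 ≤ conformalWeight φ z from sq_nonneg _), mul_comm]

end

/-- The weighted Poincaré inequality on the disc with its sharp constant. The last four conjuncts
say that the mean values occurring in the two inequalities are well defined. -/
theorem theorem2p1 (α : ℝ≥0∞) (Ω : Set ℂ) (hΩ : IsConformalRegular α Ω)
    (φ : ℂ → ℂ) (hφ : IsConformalOnto φ unitDisc Ω) :
    (∃ K : ℝ≥0,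
      (∀ (f : ℂ → ℝ) (G : ℂ → ℂ), MemWeightedSobolev unitDisc (conformalWeight φ) f G →
        eLpNorm (fun z => f z - weightedMeanValue unitDisc (conformalWeight φ) f) 2
            (weightMeasure unitDisc (conformalWeight φ)) ≤
          K * eLpNorm G 2 (volume.restrict unitDisc)) ∧
      IsLeast (weightedPoincareConstants unitDisc (conformalWeight φ)) K ∧
      IsLeast (poincareConstants Ω) K) ∧
    (0 < volume Ω ∧ volume Ω < ⊤) ∧
    (IntegrableOn (conformalWeight φ) unitDisc ∧ 0 < ∫ z in unitDisc, conformalWeight φ z) ∧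
    (∀ (f : ℂ → ℝ) (G : ℂ → ℂ), MemWeightedSobolev unitDisc (conformalWeight φ) f G →
      IntegrableOn (fun z => f z * conformalWeight φ z) unitDisc) ∧
    (∀ (g : ℂ → ℝ) (G : ℂ → ℂ), MemSobolev Ω g G → IntegrableOn g Ω) := by
  have hU := isOpen_unitDisc
  have hfin := hΩ.volume_lt_top
  have hpos : 0 < volume Ω :=
    (hφ.isOpen_image hU).measure_pos volume
      ⟨φ 0, hφ.mapsTo (Metric.mem_ball_self zero_lt_one)⟩
  -- The integrability assumption concerns some ψ, not φ: a constant is found for ψ and moved to Ω,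
  -- from where it passes to φ.
  have hne : (poincareConstants Ω).Nonempty := by
    obtain ⟨hα, ψ, hψ, hL⟩ := hΩ
    rw [← hψ.weightedPoincareConstants_eq hU]
    exact weightedPoincareConstants_nonempty hα hψ hL hfin.ne hpos.ne'
  have hleast := isLeast_sInf_poincareConstants hne
  have hleast' := hleast
  rw [← hφ.weightedPoincareConstants_eq hU] at hleast
  refine ⟨⟨_, hleast.1, hleast, ?_⟩, ⟨hpos, hfin⟩,
    ⟨hφ.integrableOn_conformalWeight hU hfin.ne, ?_⟩, fun f G hf =>
      hφ.integrableOn_mul_conformalWeight hU hfin.ne hf.memLp, fun g G hg => ?_⟩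
  · rw [hφ.weightedPoincareConstants_eq hU]
    exact hleast'
  · rw [hφ.integral_conformalWeight hU]
    exact ENNReal.toReal_pos hpos.ne' hfin.ne
  · have : IsFiniteMeasure (volume.restrict Ω) := ⟨by simpa using hfin⟩
    exact hg.memLp.integrable (by norm_num)
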